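/- Let $K$ be a field, $t\ge 0$ an integer and $S=K[x_1,\dots,x_n]$. A monomial $x_{i_1}x_{i_2}\cdots x_{i_d}$ with $i_1\le i_2\le\cdots\le i_d$ is called $t$-spread if $i_j-i_{j-1}\ge t$ for $2\le j\le d$. A $t$-spread strongly stable ideal is an ideal $I\subset S$ that is generated by $t$-spread monomials and has the property that for every $t$-spread monomial $u\in I$, every $j$ with $x_j\mid u$ and every $i<j$ such that $x_i(u/x_j)$ is $t$-spread, one has $x_i(u/x_j)\in I$. For a monomial $u=x_{i_1}x_{i_2}\cdots x_{i_d}$ with $i_1\le i_2\le\cdots\le i_d$ put $\sigma(u)=x_{i_1}x_{i_2+1}\cdots x_{i_d+(d-1)}$. For a monomial ideal $I$ let $G(I)$ be its minimal set of monomial generators, and let $I^{\sigma}$ be the ideal generated by the monomials $\sigma(u)$ with $u\in G(I)$, in a polynomial ring $K[x_1,\dots,x_m]$ with $m$ any integer large enough that this ring contains all the $\sigma(u)$, $u\in G(I)$. For a graded ideal $J$ of a standard graded polynomial ring, $\beta_{i,j}(J)$ denotes the $(i,j)$-th graded Betti number, i.e. the number of basis elements of degree $j$ of the $i$-th free module in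 a minimal graded free resolution of $J$. **Theorem.** Let $I\subset S$ be a $t$-spread strongly stable ideal. Then $I$ and $I^{\sigma}$ have minimal graded free resolutions, and, whichever such resolutions are used to compute the graded Betti numbers, $\beta_{i,i+j}(I)=\beta_{i,i+j}(I^{\sigma})$ for all $i$ and $j$. -/

import Mathlib

open MvPolynomial

/-! Monomials are represented by their exponent vectors; variables are indexed from `0`
(so `x_i` in the usual notation is the variable with index `i - 1`). -/

/-- The weakly increasing list `i₁ ≤ i₂ ≤ ⋯ ≤ i_d` of variable indices (with multiplicity) of the
monomial `x_{i₁} ⋯ x_{i_d}` with exponent vector `u`. -/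
noncomputable def sortedIndices (u : ℕ →₀ ℕ) : List ℕ :=
  u.toMultiset.sort (· ≤ ·)

/-- `u = x_{i₁} ⋯ x_{i_d}` with `i₁ ≤ ⋯ ≤ i_d` is `t`-spread: consecutive indices differ by at
least `t`. -/
def IsTSpread (t : ℕ) (u : ℕ →₀ ℕ) : Prop :=
  (sortedIndices u).IsChain (fun a b => a + t ≤ b)

/-- The stretching operator `x_{i₁} x_{i₂} ⋯ x_{i_d} ↦ x_{i₁} x_{i₂+1} ⋯ x_{i_d+(d-1)}`
(`i₁ ≤ ⋯ ≤ i_d`) on the monomials in infinitely many variables. -/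
noncomputable def stretch (u : ℕ →₀ ℕ) : ℕ →₀ ℕ :=
  Multiset.toFinsupp (((sortedIndices u).mapIdx (fun k i => i + k) : List ℕ) : Multiset ℕ)

/-- A monomial in the first `n` variables, regarded as a monomial in infinitely many variables. -/
noncomputable def extendMonomial {n : ℕ} (u : Fin n →₀ ℕ) : ℕ →₀ ℕ :=
  u.mapDomain Fin.val

section MonomialIdeals

variable {K : Type*} [Field K] {n : ℕ}

/-- `G(I)`: the monomials of `I` that are minimal with respect to divisibility, i.e. (for a monomial
ideal `I`) the unique minimal monomial set of generators of `I`. -/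
noncomputable def minimalMonomialGenerators (I : Ideal (MvPolynomial (Fin n) K)) : Set (Fin n →₀ ℕ) :=
  {u | Minimal (fun v => monomial v (1 : K) ∈ I) u}

/-- A `t`-spread monomial ideal: an ideal generated by `t`-spread monomials. -/
def IsTSpreadIdeal (t : ℕ) (I : Ideal (MvPolynomial (Fin n) K)) : Prop :=
  ∃ A : Set (Fin n →₀ ℕ), (∀ u ∈ A, IsTSpread t (extendMonomial u)) ∧
    I = Ideal.span ((fun u => monomial u (1 : K)) '' A)

/-- A `t`-spread strongly stable ideal: a `t`-spread monomial ideal such that for every `t`-spread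
monomial `u ∈ I`, every `j ∈ supp u` and every `i < j` for which `x_i (u / x_j)` is `t`-spread, one
has `x_i (u / x_j) ∈ I`. -/
def IsTSpreadStronglyStable (t : ℕ) (I : Ideal (MvPolynomial (Fin n) K)) : Prop :=
  IsTSpreadIdeal t I ∧
    ∀ u : Fin n →₀ ℕ, IsTSpread t (extendMonomial u) → monomial u (1 : K) ∈ I →
      ∀ j ∈ u.support, ∀ i < j,
        IsTSpread t (extendMonomial (u - Finsupp.single j 1 + Finsupp.single i 1)) →
          monomial (u - Finsupp.single j 1 + Finsupp.single i 1) (1 : K) ∈ I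

/-- `K[x_1, …, x_m]` has enough variables to contain all the monomials `σ(u)`, `u ∈ G(I)`. -/
def HasRoomForStretch (m : ℕ) (I : Ideal (MvPolynomial (Fin n) K)) : Prop :=
  ∀ u ∈ minimalMonomialGenerators I, ∀ i ∈ (stretch (extendMonomial u)).support, i < m

/-- The stretched ideal `I^σ`, generated by the monomials `σ(u)` with `u ∈ G(I)`, as an ideal of
`K[x_1, …, x_m]`; to be used only when `HasRoomForStretch m I`. -/
noncomputable def stretchedIdeal (m : ℕ) (I : Ideal (MvPolynomial (Fin n) K)) :
    Ideal (MvPolynomial (Fin m) K) :=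
  Ideal.span {f | ∃ w : Fin m →₀ ℕ, (∃ u ∈ minimalMonomialGenerators I,
    extendMonomial w = stretch (extendMonomial u)) ∧ f = monomial w (1 : K)}

/-- A minimal graded free resolution
`⋯ → F₂ → F₁ → F₀ → I → 0` of the ideal `I ⊆ S = K[x_1, …, x_n]` (with its standard grading).
`F i` is the free module on the finite set `B i`, the basis element `b` being placed in degree
`deg i b`, i.e. `F i = ⨁_b S(-deg i b)`. -/
structure MinimalGradedFreeResolution (I : Ideal (MvPolynomial (Fin n) K)) where
  B : ℕ → Type
  finite : ∀ i, Finite (B i)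
  deg : ∀ i, B i → ℕ
  /-- the differentials -/
  d : ∀ i, (B (i + 1) →₀ MvPolynomial (Fin n) K) →ₗ[MvPolynomial (Fin n) K]
    (B i →₀ MvPolynomial (Fin n) K)
  /-- the augmentation, as a map into `S` with image `I` -/
  ε : (B 0 →₀ MvPolynomial (Fin n) K) →ₗ[MvPolynomial (Fin n) K] MvPolynomial (Fin n) K
  /-- the augmentation preserves degrees -/
  ε_homogeneous : ∀ b, (ε (Finsupp.single b 1)).IsHomogeneous (deg 0 b)
  /-- the differentials preserve degrees -/
  d_homogeneous : ∀ i b a, ∀ s ∈ (d i (Finsupp.single b 1) a).support,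
    deg i a + s.degree = deg (i + 1) b
  range_ε : LinearMap.range ε = I
  exact_zero : Function.Exact (d 0) ε
  exact_succ : ∀ i, Function.Exact (d (i + 1)) (d i)
  /-- minimality: `d (F (i + 1)) ⊆ 𝔪 F i`, where `𝔪 = (x_1, …, x_n)` -/
  minimal : ∀ i, LinearMap.range (d i) ≤
    Ideal.span (Set.range (X : Fin n → MvPolynomial (Fin n) K)) •
      (⊤ : Submodule (MvPolynomial (Fin n) K) (B i →₀ MvPolynomial (Fin n) K))

/-- The graded Betti number `β_{i,j}`: the number of basis elements of degree `j` of the `i`-th free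
module of a minimal graded free resolution. -/
noncomputable def MinimalGradedFreeResolution.betti {I : Ideal (MvPolynomial (Fin n) K)}
    (F : MinimalGradedFreeResolution I) (i j : ℕ) : ℕ :=
  Nat.card {b : F.B i // F.deg i b = j}

end MonomialIdeals

/-! Both ideals have linear quotients, and the colon ideals that occur need equally many variables.
Order the generators by degree, then by the sum of their indices. For a generator `u =
x_{u₁}⋯x_{u_d}`, the ideal of its predecessors has a colon ideal by `u` that is generated by the
variables with index in the gaps `[0, u₁)`, `[u₁ + t, u₂)`, `[u₂ + t, u₃)`, …
(`IsSpreadSystem.exists_le_add_iff`). An ideal generated by `g` variables has Koszul Betti numbers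
(`hasBettiNumbers_span_X`), and adjoining `u` to its predecessors is a mapping cone
(`HasBettiNumbers.sup_span_singleton`). The cone is minimal because no predecessor has degree above
`d`. By induction, `β_{i,i+j}` is the sum of `choose g(u) i` over the generators `u` of degree `j`,
where `g(u)` is the total length of the gaps.

Stretching raises each difference of consecutive indices by one; with `t + 1` in place of `t`, the
gaps keep their lengths (`gapCount_stretchList`), and degrees do not change. The properties of the
generators that the computation uses are isolated in `IsSpreadSystem`. They hold for `G(I)` and pass
directly to the stretched lists (`IsSpreadSystem.stretch`), so neither strong stability of `I^σ` nor
minimality of the generators `σ(u)` has to be established separately.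

All this concerns one constructed resolution of each ideal. Graded Nakayama makes minimal
resolutions unique up to graded isomorphism in each homological degree, so any other choice gives
the same numbers (`betti_eq_betti`). -/

/-! ### Graded maps of free modules and graded Nakayama. -/

section GradedFreeModules

variable {K : Type*} [Field K] {n : ℕ} {B C D : Type*}

/-- The vector `v` of the graded free module `⨁_b S(-deg b)` is homogeneous of degree `j`. -/
def IsHomogeneousVector (deg : B → ℕ) (j : ℕ) (v : B →₀ MvPolynomial (Fin n) K) : Prop :=
  ∀ a, ∀ s ∈ (v a).support, deg a + s.degree = j

/-- The linear map `φ : ⨁_b S(-degB b) → ⨁_c S(-degC c)` preserves degrees. -/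
def IsGradedMap (degB : B → ℕ) (degC : C → ℕ)
    (φ : (B →₀ MvPolynomial (Fin n) K) →ₗ[MvPolynomial (Fin n) K] (C →₀ MvPolynomial (Fin n) K)) :
    Prop :=
  ∀ b, IsHomogeneousVector degC (degB b) (φ (Finsupp.single b 1))

/-- The homogeneous component of degree `j` of a vector of `⨁_b S(-deg b)`. -/
noncomputable def gradedPart (deg : B → ℕ) (j : ℕ) (v : B →₀ MvPolynomial (Fin n) K) :
    B →₀ MvPolynomial (Fin n) K :=
  Finsupp.onFinset v.support
    (fun a => if deg a ≤ j then homogeneousComponent (j - deg a) (v a) else 0) (by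
      intro a h
      contrapose! h
      simp [Finsupp.notMem_support_iff.1 h])

theorem coeff_gradedPart (deg : B → ℕ) (j : ℕ) (v : B →₀ MvPolynomial (Fin n) K) (a : B)
    (s : Fin n →₀ ℕ) :
    coeff s (gradedPart deg j v a) = if deg a + s.degree = j then coeff s (v a) else 0 := by
  simp only [gradedPart, Finsupp.onFinset_apply]
  split_ifs with h1 h2 h2
  · rw [coeff_homogeneousComponent, if_pos (by omega)]
  · rw [coeff_homogeneousComponent, if_neg (by omega)]
  · omega
  · simp

theorem gradedPart_add (deg : B → ℕ) (j : ℕ) (v w : B →₀ MvPolynomial (Fin n) K) :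
    gradedPart deg j (v + w) = gradedPart deg j v + gradedPart deg j w := by
  ext a s
  simp only [Finsupp.add_apply, coeff_add, coeff_gradedPart]
  split_ifs <;> simp

theorem gradedPart_zero (deg : B → ℕ) (j : ℕ) :
    gradedPart deg j (0 : B →₀ MvPolynomial (Fin n) K) = 0 := by
  ext a s
  simp [coeff_gradedPart]

theorem isHomogeneousVector_gradedPart (deg : B → ℕ) (j : ℕ) (v : B →₀ MvPolynomial (Fin n) K) :
    IsHomogeneousVector deg j (gradedPart deg j v) := by
  intro a s hs
  rw [mem_support_iff, coeff_gradedPart] at hs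
  by_contra h
  exact hs (if_neg h)

theorem IsHomogeneousVector.gradedPart_eq {deg : B → ℕ} {k : ℕ} {v : B →₀ MvPolynomial (Fin n) K}
    (hv : IsHomogeneousVector deg k v) (j : ℕ) :
    gradedPart deg j v = if k = j then v else 0 := by
  ext a s
  rw [coeff_gradedPart]
  by_cases hs : s ∈ (v a).support
  · rw [hv a s hs]
    split_ifs <;> simp
  · rw [notMem_support_iff] at hs
    split_ifs <;> simp [hs]

theorem isHomogeneousVector_zero (deg : B → ℕ) (j : ℕ) :
    IsHomogeneousVector deg j (0 : B →₀ MvPolynomial (Fin n) K) := by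
  intro a s hs
  simp at hs

theorem IsHomogeneousVector.add {deg : B → ℕ} {j : ℕ} {v w : B →₀ MvPolynomial (Fin n) K}
    (hv : IsHomogeneousVector deg j v) (hw : IsHomogeneousVector deg j w) :
    IsHomogeneousVector deg j (v + w) := by
  classical
  intro a s hs
  rcases Finset.mem_union.1 (support_add hs) with h | h
  · exact hv a s h
  · exact hw a s h

theorem IsHomogeneousVector.neg {deg : B → ℕ} {j : ℕ} {v : B →₀ MvPolynomial (Fin n) K}
    (hv : IsHomogeneousVector deg j v) : IsHomogeneousVector deg j (-v) := by
  intro a s hs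
  exact hv a s (by simpa using hs)

theorem IsHomogeneousVector.smul {deg : B → ℕ} {j k : ℕ} {v : B →₀ MvPolynomial (Fin n) K}
    (hv : IsHomogeneousVector deg j v) {p : MvPolynomial (Fin n) K}
    (hp : ∀ s ∈ p.support, s.degree = k) : IsHomogeneousVector deg (k + j) (p • v) := by
  classical
  intro a s hs
  rw [Finsupp.smul_apply, smul_eq_mul] at hs
  obtain ⟨s₁, h₁, s₂, h₂, rfl⟩ := Finset.mem_add.1 (support_mul _ _ hs)
  have := hp _ h₁
  have := hv _ _ h₂
  rw [map_add]
  omega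

theorem isHomogeneousVector_single (deg : B → ℕ) (b : B) :
    IsHomogeneousVector deg (deg b)
      (Finsupp.single b 1 : B →₀ MvPolynomial (Fin n) K) := by
  classical
  intro a s hs
  rw [Finsupp.single_apply] at hs
  split_ifs at hs with h
  · subst h
    have : s = 0 := by
      by_contra h0
      rw [mem_support_iff, coeff_one, if_neg (Ne.symm h0)] at hs
      exact hs rfl
    simp [this]
  · simp at hs

/-- This is what makes an arbitrary preimage of a homogeneous vector replaceable by a homogeneous
one: take its component of the right degree. -/
theorem IsGradedMap.gradedPart_map {degB : B → ℕ} {degC : C → ℕ}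
    {φ : (B →₀ MvPolynomial (Fin n) K) →ₗ[MvPolynomial (Fin n) K]
      (C →₀ MvPolynomial (Fin n) K)} (hφ : IsGradedMap degB degC φ) (j : ℕ)
    (v : B →₀ MvPolynomial (Fin n) K) :
    gradedPart degC j (φ v) = φ (gradedPart degB j v) := by
  induction v using Finsupp.induction_linear with
  | zero => simp [gradedPart_zero]
  | add v w hv hw => simp [gradedPart_add, hv, hw]
  | single b p =>
    induction p using MvPolynomial.induction_on' with
    | monomial s r =>
      have hm : ∀ q ∈ (monomial s r : MvPolynomial (Fin n) K).support, q.degree = s.degree := by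
        intro q hq
        rw [Finset.mem_singleton.1 (support_monomial_subset hq)]
      have h : (Finsupp.single b (monomial s r) : B →₀ MvPolynomial (Fin n) K)
          = monomial s r • Finsupp.single b 1 := by simp
      rw [h, ((isHomogeneousVector_single degB b).smul hm).gradedPart_eq, map_smul,
        ((hφ b).smul hm).gradedPart_eq]
      split_ifs
      · rw [map_smul]
      · rw [map_zero]
    | add p q hp hq => simp [Finsupp.single_add, gradedPart_add, hp, hq]

theorem IsGradedMap.map_homogeneous {degB : B → ℕ} {degC : C → ℕ}
    {φ : (B →₀ MvPolynomial (Fin n) K) →ₗ[MvPolynomial (Fin n) K]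
      (C →₀ MvPolynomial (Fin n) K)} (hφ : IsGradedMap degB degC φ) {j : ℕ}
    {v : B →₀ MvPolynomial (Fin n) K} (hv : IsHomogeneousVector degB j v) :
    IsHomogeneousVector degC j (φ v) := by
  have h := hφ.gradedPart_map j v
  rw [hv.gradedPart_eq, if_pos rfl] at h
  rw [← h]
  exact isHomogeneousVector_gradedPart _ _ _

theorem IsGradedMap.comp {degB : B → ℕ} {degC : C → ℕ} {degD : D → ℕ}
    {ψ : (C →₀ MvPolynomial (Fin n) K) →ₗ[MvPolynomial (Fin n) K] (D →₀ MvPolynomial (Fin n) K)}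
    {φ : (B →₀ MvPolynomial (Fin n) K) →ₗ[MvPolynomial (Fin n) K] (C →₀ MvPolynomial (Fin n) K)}
    (hψ : IsGradedMap degC degD ψ) (hφ : IsGradedMap degB degC φ) :
    IsGradedMap degB degD (ψ ∘ₗ φ) :=
  fun b => hψ.map_homogeneous (hφ b)

theorem IsGradedMap.neg {degB : B → ℕ} {degC : C → ℕ}
    {φ : (B →₀ MvPolynomial (Fin n) K) →ₗ[MvPolynomial (Fin n) K] (C →₀ MvPolynomial (Fin n) K)}
    (hφ : IsGradedMap degB degC φ) : IsGradedMap degB degC (-φ) :=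
  fun b => (hφ b).neg

theorem isGradedMap_id (degB : B → ℕ) :
    IsGradedMap degB degB
      (LinearMap.id : (B →₀ MvPolynomial (Fin n) K) →ₗ[MvPolynomial (Fin n) K] _) :=
  fun b => isHomogeneousVector_single degB b

/-- The inverse of a graded isomorphism is graded. -/
theorem IsGradedMap.symm {degB : B → ℕ} {degC : C → ℕ}
    {e : (B →₀ MvPolynomial (Fin n) K) ≃ₗ[MvPolynomial (Fin n) K] (C →₀ MvPolynomial (Fin n) K)}
    (he : IsGradedMap degB degC e.toLinearMap) : IsGradedMap degC degB e.symm.toLinearMap := by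
  intro c
  have h := he.gradedPart_map (degC c) (e.symm (Finsupp.single c 1))
  simp only [LinearEquiv.coe_coe, LinearEquiv.apply_symm_apply] at h
  rw [(isHomogeneousVector_single degC c).gradedPart_eq, if_pos rfl] at h
  simp only [LinearEquiv.coe_coe]
  rw [h, LinearEquiv.symm_apply_apply]
  exact isHomogeneousVector_gradedPart _ _ _

/-- Graded free modules are projective for graded maps. -/
theorem IsGradedMap.exists_lift {degB : B → ℕ} {degC : C → ℕ} {degD : D → ℕ}
    {φ : (C →₀ MvPolynomial (Fin n) K) →ₗ[MvPolynomial (Fin n) K] (D →₀ MvPolynomial (Fin n) K)}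
    {ψ : (B →₀ MvPolynomial (Fin n) K) →ₗ[MvPolynomial (Fin n) K] (D →₀ MvPolynomial (Fin n) K)}
    (hφ : IsGradedMap degC degD φ) (hψ : IsGradedMap degB degD ψ)
    (h : LinearMap.range ψ ≤ LinearMap.range φ) :
    ∃ c : (B →₀ MvPolynomial (Fin n) K) →ₗ[MvPolynomial (Fin n) K] (C →₀ MvPolynomial (Fin n) K),
      IsGradedMap degB degC c ∧ φ ∘ₗ c = ψ := by
  have key : ∀ b, ∃ y, IsHomogeneousVector degC (degB b) y ∧ φ y = ψ (Finsupp.single b 1) := by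
    intro b
    obtain ⟨x, hx⟩ := h ⟨Finsupp.single b 1, rfl⟩
    refine ⟨gradedPart degC (degB b) x, isHomogeneousVector_gradedPart _ _ _, ?_⟩
    rw [← hφ.gradedPart_map, hx, (hψ b).gradedPart_eq, if_pos rfl]
  choose y hy using key
  refine ⟨Finsupp.linearCombination _ y, fun b => ?_, ?_⟩
  · simpa using (hy b).1
  · ext b : 2
    simp [(hy b).2]

theorem mem_span_range_X_iff {p : MvPolynomial (Fin n) K} :
    p ∈ Ideal.span (Set.range (X : Fin n → MvPolynomial (Fin n) K)) ↔ constantCoeff p = 0 := by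
  rw [← Set.image_univ, mem_ideal_span_X_image]
  constructor
  · intro h
    by_contra h0
    obtain ⟨i, -, hi⟩ := h 0 (mem_support_iff.2 (by simpa [constantCoeff_eq] using h0))
    exact hi rfl
  · intro h m hm
    by_contra! h0
    have : m = 0 := Finsupp.ext fun i => h0 i trivial
    subst this
    exact mem_support_iff.1 hm (by simpa [constantCoeff_eq] using h)

theorem mem_irrelevant_smul_top_iff {v : B →₀ MvPolynomial (Fin n) K} :
    v ∈ Ideal.span (Set.range (X : Fin n → MvPolynomial (Fin n) K)) •
      (⊤ : Submodule (MvPolynomial (Fin n) K) (B →₀ MvPolynomial (Fin n) K)) ↔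
      ∀ a, constantCoeff (v a) = 0 := by
  constructor
  · intro h a
    induction h using Submodule.smul_induction_on' with
    | smul r hr x _ => simp [mem_span_range_X_iff.1 hr]
    | add x _ y _ hx hy => simp [hx, hy]
  · intro h
    rw [← Finsupp.sum_single v]
    refine Submodule.sum_mem _ fun a _ => ?_
    rw [show Finsupp.single a (v a) = v a • Finsupp.single a 1 by simp]
    exact Submodule.smul_mem_smul (mem_span_range_X_iff.2 (h a)) trivial

/-- The graded Nakayama lemma for an endomorphism that is the identity modulo `𝔪`. -/
theorem IsGradedMap.surjective_of_constantCoeff {degB : B → ℕ}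
    {φ : (B →₀ MvPolynomial (Fin n) K) →ₗ[MvPolynomial (Fin n) K] (B →₀ MvPolynomial (Fin n) K)}
    (hφ : IsGradedMap degB degB φ)
    (h : ∀ b a, constantCoeff ((φ (Finsupp.single b 1) - Finsupp.single b 1 :
      B →₀ MvPolynomial (Fin n) K) a) = 0) :
    Function.Surjective φ := by
  have key : ∀ N b, degB b = N → Finsupp.single b 1 ∈ LinearMap.range φ := by
    intro N
    induction N using Nat.strong_induction_on with
    | _ N ih =>
      rintro b rfl
      set w := φ (Finsupp.single b 1) - Finsupp.single b 1 with hw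
      have hwh : IsHomogeneousVector degB (degB b) w := by
        rw [hw, sub_eq_add_neg]
        exact (hφ b).add (isHomogeneousVector_single degB b).neg
      have hmem : w ∈ LinearMap.range φ := by
        rw [← Finsupp.sum_single w]
        refine Submodule.sum_mem _ fun a ha => ?_
        rw [show Finsupp.single a (w a) = w a • Finsupp.single a 1 by simp]
        -- The error `w` has degree `degB b` and no constant terms, so it involves only basis
        -- elements of strictly smaller degree.
        refine Submodule.smul_mem _ _ (ih (degB a) ?_ a rfl)
        obtain ⟨s, hs⟩ := MvPolynomial.support_nonempty.2 (Finsupp.mem_support_iff.1 ha)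
        have h1 := hwh a s hs
        have h2 : s.degree ≠ 0 := by
          intro h0
          rw [Finsupp.degree_eq_zero_iff] at h0
          subst h0
          exact mem_support_iff.1 hs (h b a)
        omega
      have : Finsupp.single b 1 = φ (Finsupp.single b 1) - w := by rw [hw]; abel
      rw [this]
      exact Submodule.sub_mem _ ⟨_, rfl⟩ hmem
  rw [← LinearMap.range_eq_top, eq_top_iff, ← Finsupp.basisSingleOne.span_eq, Submodule.span_le]
  rintro _ ⟨b, rfl⟩
  simpa using key _ b rfl

/-- Two minimal graded covers of isomorphic graded modules are isomorphic. -/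
theorem IsGradedMap.exists_equiv_of_minimal {P Q : Type*} [Finite B] [Finite C] {degB : B → ℕ}
    {degC : C → ℕ} {degP : P → ℕ} {degQ : Q → ℕ}
    {φ : (B →₀ MvPolynomial (Fin n) K) →ₗ[MvPolynomial (Fin n) K] (P →₀ MvPolynomial (Fin n) K)}
    {ψ : (C →₀ MvPolynomial (Fin n) K) →ₗ[MvPolynomial (Fin n) K] (Q →₀ MvPolynomial (Fin n) K)}
    {α : (P →₀ MvPolynomial (Fin n) K) ≃ₗ[MvPolynomial (Fin n) K] (Q →₀ MvPolynomial (Fin n) K)}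
    (hφ : IsGradedMap degB degP φ) (hψ : IsGradedMap degC degQ ψ)
    (hα : IsGradedMap degP degQ α.toLinearMap)
    (hr : (LinearMap.range φ).map α.toLinearMap = LinearMap.range ψ)
    (hφm : ∀ v, φ v = 0 → ∀ a, constantCoeff (v a) = 0)
    (hψm : ∀ v, ψ v = 0 → ∀ a, constantCoeff (v a) = 0) :
    ∃ e : (B →₀ MvPolynomial (Fin n) K) ≃ₗ[MvPolynomial (Fin n) K] (C →₀ MvPolynomial (Fin n) K),
      IsGradedMap degB degC e.toLinearMap ∧
      (LinearMap.ker φ).map e.toLinearMap = LinearMap.ker ψ := by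
  obtain ⟨f, hf, hfc⟩ := hψ.exists_lift (hα.comp hφ) (by
    rw [LinearMap.range_comp, hr])
  obtain ⟨g, hg, hgc⟩ := hφ.exists_lift (hα.symm.comp hψ) (by
    rw [LinearMap.range_comp, ← hr, ← Submodule.map_comp]
    simp)
  have hfc' : ∀ x, ψ (f x) = α (φ x) := fun x => LinearMap.congr_fun hfc x
  have hgc' : ∀ x, φ (g x) = α.symm (ψ x) := fun x => LinearMap.congr_fun hgc x
  -- Since `g ∘ f` lifts the identity through `φ`, it differs from the identity by vectors of `ker
  -- φ`, which minimality places in `𝔪` times the free module. Nakayama then gives surjectivity, and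
  -- the Orzech property injectivity.
  have h1 : Function.Surjective (g ∘ₗ f) := by
    refine IsGradedMap.surjective_of_constantCoeff (hg.comp hf) fun b a => hφm _ ?_ a
    simp [hgc', hfc']
  have h2 : Function.Surjective (f ∘ₗ g) := by
    refine IsGradedMap.surjective_of_constantCoeff (hf.comp hg) fun b a => hψm _ ?_ a
    simp [hgc', hfc']
  have h1' := OrzechProperty.injective_of_surjective_endomorphism _ h1
  have hbij : Function.Bijective f :=
    ⟨Function.Injective.of_comp (f := g) h1', Function.Surjective.of_comp (g := g) h2⟩
  refine ⟨LinearEquiv.ofBijective f hbij, hf, ?_⟩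
  ext y
  constructor
  · rintro ⟨x, hx, rfl⟩
    simp [hfc', LinearMap.mem_ker.1 hx]
  · intro hy
    obtain ⟨x, rfl⟩ := hbij.2 y
    refine ⟨x, ?_, rfl⟩
    have h3 := hfc' x
    rw [LinearMap.mem_ker.1 hy] at h3
    exact (α.map_eq_zero_iff.1 h3.symm)

theorem apply_eq_sum_mul [Fintype C]
    (φ : (C →₀ MvPolynomial (Fin n) K) →ₗ[MvPolynomial (Fin n) K] (B →₀ MvPolynomial (Fin n) K))
    (v : C →₀ MvPolynomial (Fin n) K) (b : B) :
    φ v b = ∑ c, v c * φ (Finsupp.single c 1) b := by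
  conv_lhs => rw [← Finsupp.univ_sum_single v]
  rw [map_sum, Finsupp.finsetSum_apply]
  refine Finset.sum_congr rfl fun c _ => ?_
  rw [show Finsupp.single c (v c) = v c • Finsupp.single c 1 by simp, map_smul]
  simp

theorem IsGradedMap.constantCoeff_eq_zero {degB : B → ℕ} {degC : C → ℕ}
    {φ : (B →₀ MvPolynomial (Fin n) K) →ₗ[MvPolynomial (Fin n) K] (C →₀ MvPolynomial (Fin n) K)}
    (hφ : IsGradedMap degB degC φ) {b : B} {c : C} (h : degC c ≠ degB b) :
    constantCoeff (φ (Finsupp.single b 1) c) = 0 := by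
  by_contra h0
  exact h (by simpa using hφ b c 0 (mem_support_iff.2 (by simpa [constantCoeff_eq] using h0)))

/-- Modulo `𝔪` a graded map is block diagonal by degree, so reducing `e` and its inverse yields
mutually inverse blocks. Such blocks must be square, which is how the numbers of basis elements are
compared. -/
theorem IsGradedMap.matrix_mul_symm [Fintype B] [Fintype C] [DecidableEq B] {degB : B → ℕ}
    {degC : C → ℕ}
    {e : (B →₀ MvPolynomial (Fin n) K) ≃ₗ[MvPolynomial (Fin n) K] (C →₀ MvPolynomial (Fin n) K)}
    (he : IsGradedMap degB degC e.toLinearMap) (j : ℕ) :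
    (Matrix.of fun (b : {b // degB b = j}) (c : {c // degC c = j}) =>
        constantCoeff (e (Finsupp.single b.1 1) c.1)) *
      (Matrix.of fun (c : {c // degC c = j}) (b : {b // degB b = j}) =>
        constantCoeff (e.symm (Finsupp.single c.1 1) b.1)) = (1 : Matrix _ _ K) := by
  ext ⟨b, hb⟩ ⟨b', hb'⟩
  have h := apply_eq_sum_mul e.symm.toLinearMap (e (Finsupp.single b 1)) b'
  apply_fun constantCoeff at h
  simp only [LinearEquiv.coe_coe, LinearEquiv.symm_apply_apply, map_sum, map_mul] at h
  rw [Matrix.mul_apply, Matrix.one_apply]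
  simp only [Matrix.of_apply, Subtype.mk.injEq]
  have h1 : (∑ c, constantCoeff (e (Finsupp.single b 1) c) *
      constantCoeff (e.symm (Finsupp.single c 1) b')) =
      ∑ c : {c // degC c = j}, constantCoeff (e (Finsupp.single b 1) c.1) *
        constantCoeff (e.symm (Finsupp.single c.1 1) b') := by
    rw [← Finset.sum_subtype (Finset.univ.filter (degC · = j)) (by simp) (fun c =>
      constantCoeff (e (Finsupp.single b 1) c) * constantCoeff (e.symm (Finsupp.single c 1) b'))]
    refine (Finset.sum_filter_of_ne fun c _ hc => ?_).symm
    by_contra hcj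
    refine hc ?_
    have := he.constantCoeff_eq_zero (b := b) (c := c) (by omega)
    rw [LinearEquiv.coe_coe] at this
    rw [this, zero_mul]
  rw [← h1, ← h, Finsupp.single_apply]
  split_ifs <;> simp

/-- Isomorphic graded free modules have equally many basis elements in each degree. -/
theorem IsGradedMap.card_eq [Finite B] [Finite C] {degB : B → ℕ} {degC : C → ℕ}
    {e : (B →₀ MvPolynomial (Fin n) K) ≃ₗ[MvPolynomial (Fin n) K] (C →₀ MvPolynomial (Fin n) K)}
    (he : IsGradedMap degB degC e.toLinearMap) (j : ℕ) :
    Nat.card {b // degB b = j} = Nat.card {c // degC c = j} := by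
  classical
  have := Fintype.ofFinite B
  have := Fintype.ofFinite C
  rw [Nat.card_eq_fintype_card, Nat.card_eq_fintype_card]
  exact Matrix.square_of_invertible _ _ (he.matrix_mul_symm j) (he.symm.matrix_mul_symm j)

end GradedFreeModules

/-! ### Uniqueness of minimal resolutions, and comparison maps. -/

section Resolutions

variable {K : Type*} [Field K] {n : ℕ} {I J L : Ideal (MvPolynomial (Fin n) K)}

namespace MinimalGradedFreeResolution

/-- The augmentation of a resolution as a graded map to the free module `S`. -/
noncomputable def augmentation (F : MinimalGradedFreeResolution I) :
    (F.B 0 →₀ MvPolynomial (Fin n) K) →ₗ[MvPolynomial (Fin n) K]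
      (Unit →₀ MvPolynomial (Fin n) K) :=
  Finsupp.lsingle () ∘ₗ F.ε

theorem augmentation_apply (F : MinimalGradedFreeResolution I)
    (x : F.B 0 →₀ MvPolynomial (Fin n) K) : F.augmentation x = Finsupp.single () (F.ε x) := rfl

theorem augmentation_eq_zero_iff (F : MinimalGradedFreeResolution I)
    (x : F.B 0 →₀ MvPolynomial (Fin n) K) : F.augmentation x = 0 ↔ F.ε x = 0 := by
  simp [augmentation_apply]

theorem isGradedMap_augmentation (F : MinimalGradedFreeResolution I) :
    IsGradedMap (F.deg 0) (fun _ : Unit => 0) F.augmentation := by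
  intro b a s hs
  rw [augmentation_apply, Finsupp.single_eq_same] at hs
  have h := F.ε_homogeneous b (mem_support_iff.1 hs)
  rw [Finsupp.degree_eq_weight_one, zero_add]
  exact h

theorem isGradedMap_d (F : MinimalGradedFreeResolution I) (i : ℕ) :
    IsGradedMap (F.deg (i + 1)) (F.deg i) (F.d i) :=
  F.d_homogeneous i

theorem mem_range_ε_iff (F : MinimalGradedFreeResolution I) {f : MvPolynomial (Fin n) K} :
    f ∈ LinearMap.range F.ε ↔ f ∈ I := by
  rw [F.range_ε]

theorem ε_mem (F : MinimalGradedFreeResolution I) (x : F.B 0 →₀ MvPolynomial (Fin n) K) :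
    F.ε x ∈ I :=
  F.mem_range_ε_iff.1 ⟨x, rfl⟩

theorem constantCoeff_of_mem_range (F : MinimalGradedFreeResolution I) {i : ℕ}
    {x : F.B i →₀ MvPolynomial (Fin n) K} (hx : x ∈ LinearMap.range (F.d i)) (a : F.B i) :
    constantCoeff (x a) = 0 :=
  mem_irrelevant_smul_top_iff.1 (F.minimal i hx) a

theorem range_d_zero (F : MinimalGradedFreeResolution I) :
    LinearMap.range (F.d 0) = LinearMap.ker F.augmentation := by
  rw [← LinearMap.exact_iff.1 F.exact_zero]
  ext x
  simp [augmentation_eq_zero_iff]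

theorem range_d_succ (F : MinimalGradedFreeResolution I) (i : ℕ) :
    LinearMap.range (F.d (i + 1)) = LinearMap.ker (F.d i) :=
  (LinearMap.exact_iff.1 (F.exact_succ i)).symm

/-- The isomorphism is carried together with its effect on the image of the next differential. By
exactness that image is the syzygy module, of which both next free modules are minimal covers, so
the induction continues. -/
theorem exists_graded_equiv (F G : MinimalGradedFreeResolution I) (i : ℕ) :
    ∃ e : (F.B i →₀ MvPolynomial (Fin n) K) ≃ₗ[MvPolynomial (Fin n) K]
        (G.B i →₀ MvPolynomial (Fin n) K),
      IsGradedMap (F.deg i) (G.deg i) e.toLinearMap ∧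
      (LinearMap.range (F.d i)).map e.toLinearMap = LinearMap.range (G.d i) := by
  induction i with
  | zero =>
    have := F.finite 0
    have := G.finite 0
    rw [F.range_d_zero, G.range_d_zero]
    refine F.isGradedMap_augmentation.exists_equiv_of_minimal G.isGradedMap_augmentation
      (α := LinearEquiv.refl _ _) (isGradedMap_id _) ?_ (fun v hv => ?_) (fun v hv => ?_)
    · rw [augmentation, augmentation, LinearMap.range_comp, LinearMap.range_comp, F.range_ε,
        G.range_ε]
      exact Submodule.map_id _
    · exact F.constantCoeff_of_mem_range (by rw [F.range_d_zero]; exact hv)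
    · exact G.constantCoeff_of_mem_range (by rw [G.range_d_zero]; exact hv)
  | succ i ih =>
    have := F.finite (i + 1)
    have := G.finite (i + 1)
    obtain ⟨α, hα, hr⟩ := ih
    rw [F.range_d_succ, G.range_d_succ]
    refine (F.isGradedMap_d i).exists_equiv_of_minimal (G.isGradedMap_d i) hα hr
      (fun v hv => ?_) (fun v hv => ?_)
    · exact F.constantCoeff_of_mem_range (by rw [F.range_d_succ]; exact hv)
    · exact G.constantCoeff_of_mem_range (by rw [G.range_d_succ]; exact hv)

/-- The graded Betti numbers do not depend on the minimal graded free resolution. -/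
theorem betti_eq_betti (F G : MinimalGradedFreeResolution I) (i j : ℕ) :
    F.betti i j = G.betti i j := by
  have := F.finite i
  have := G.finite i
  obtain ⟨e, he, -⟩ := F.exists_graded_equiv G i
  exact he.card_eq j

end MinimalGradedFreeResolution

/-- Dependent choice with varying types: `P` is the invariant that makes the next lift possible, and
`R` ties consecutive choices together. It builds chain maps one homological degree at a time. -/
theorem exists_dependent_sequence {α : ℕ → Type*} {P : ∀ i, α i → Prop}
    {R : ∀ i, α i → α (i + 1) → Prop} (h0 : ∃ a, P 0 a)
    (hs : ∀ i a, P i a → ∃ b, P (i + 1) b ∧ R i a b) :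
    ∃ f : ∀ i, α i, (∀ i, P i (f i)) ∧ P 0 (f 0) ∧ ∀ i, R i (f i) (f (i + 1)) := by
  obtain ⟨a, ha⟩ := h0
  choose g hg using hs
  let f : ∀ i, {a : α i // P i a} :=
    fun i => Nat.rec ⟨a, ha⟩ (fun i a => ⟨g i a.1 a.2, (hg i a.1 a.2).1⟩) i
  exact ⟨fun i => (f i).1, fun i => (f i).2, (f 0).2, fun i => (hg i (f i).1 (f i).2).2⟩

namespace MinimalGradedFreeResolution

/-- A chain map, up to sign, that lifts the multiplication by `u` as a map `L(-d) → J`. -/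
theorem exists_comparison (F : MinimalGradedFreeResolution J) (G : MinimalGradedFreeResolution L)
    {u : MvPolynomial (Fin n) K} {d : ℕ} (hu : ∀ s ∈ u.support, s.degree = d)
    (h : ∀ f ∈ L, f * u ∈ J) :
    ∃ c : ∀ i, (G.B i →₀ MvPolynomial (Fin n) K) →ₗ[MvPolynomial (Fin n) K]
        (F.B i →₀ MvPolynomial (Fin n) K),
      (∀ i, IsGradedMap (fun b => d + G.deg i b) (F.deg i) (c i)) ∧
      (∀ x, F.ε (c 0 x) = -(u * G.ε x)) ∧
      ∀ i x, F.d i (c (i + 1) x) = -c i (G.d i x) := by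
  have shift : ∀ {B C : Type} {degB : B → ℕ} {degC : C → ℕ}
      {φ : (B →₀ MvPolynomial (Fin n) K) →ₗ[MvPolynomial (Fin n) K]
        (C →₀ MvPolynomial (Fin n) K)}, IsGradedMap degB degC φ →
        IsGradedMap (fun b => d + degB b) (fun c => d + degC c) φ := by
    intro B C degB degC φ hφ b a s hs
    have := hφ b a s hs
    simp only
    omega
  have hseq := exists_dependent_sequence
    (α := fun i => (G.B i →₀ MvPolynomial (Fin n) K) →ₗ[MvPolynomial (Fin n) K]
        (F.B i →₀ MvPolynomial (Fin n) K))
    -- The middle clause guarantees that the next component can be lifted. The last clause records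
    -- compatibility with the augmentations and only says something for `i = 0`.
    (P := fun i c => IsGradedMap (fun b => d + G.deg i b) (F.deg i) c ∧
      (∀ x, c (G.d i x) ∈ LinearMap.range (F.d i)) ∧
      ∀ hi : i = 0, ∀ x, F.ε ((hi ▸ c) x) = -(u * G.ε x))
    (R := fun i c c' => ∀ x, F.d i (c' x) = -c (G.d i x))
  refine Exists.elim (hseq ?_ ?_) fun c ⟨hc, h0, hR⟩ => ⟨c, fun i => (hc i).1, h0.2.2 rfl, hR⟩
  · have hψ : IsGradedMap (fun b => d + G.deg 0 b) (fun _ => 0) (-(u • G.augmentation)) := by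
      intro b
      rw [LinearMap.neg_apply, LinearMap.smul_apply]
      exact ((G.isGradedMap_augmentation b).smul hu).neg
    obtain ⟨c, hc, hcc⟩ := F.isGradedMap_augmentation.exists_lift hψ (by
      rintro _ ⟨x, rfl⟩
      obtain ⟨y, hy⟩ := F.mem_range_ε_iff.2 (h _ (G.ε_mem x))
      refine ⟨-y, ?_⟩
      simp [augmentation_apply, hy, mul_comm])
    have hε : ∀ x, F.ε (c x) = -(u * G.ε x) := by
      intro x
      have := LinearMap.congr_fun hcc x
      simp only [LinearMap.comp_apply, augmentation_apply, LinearMap.neg_apply,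
        LinearMap.smul_apply, Finsupp.smul_single, smul_eq_mul, ← Finsupp.single_neg] at this
      exact Finsupp.single_injective _ this
    refine ⟨c, hc, fun x => ?_, fun _ => hε⟩
    exact (F.exact_zero _).1 (by rw [hε, G.exact_zero.apply_apply_eq_zero, mul_zero, neg_zero])
  · rintro i c ⟨hc, hr, -⟩
    obtain ⟨c', hc', hcc⟩ := (F.isGradedMap_d i).exists_lift
      (hc.comp (shift (G.isGradedMap_d i))).neg (by
        rintro _ ⟨x, rfl⟩
        exact Submodule.neg_mem _ (hr x))
    have hd : ∀ x, F.d i (c' x) = -c (G.d i x) := fun x => LinearMap.congr_fun hcc x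
    refine ⟨c', ⟨hc', fun x => ?_, fun hi => by omega⟩, hd⟩
    exact (F.exact_succ i _).1 (by
      rw [hd, (G.exact_succ i).apply_apply_eq_zero, map_zero, neg_zero])

end MinimalGradedFreeResolution

end Resolutions

/-! ### The mapping cone of multiplication by `u`. -/

section MappingCone

variable {K : Type*} [Field K] {n : ℕ} {I J L : Ideal (MvPolynomial (Fin n) K)}

/-- The ideal `J` has a minimal graded free resolution with graded Betti numbers `β`. -/
def HasBettiNumbers (J : Ideal (MvPolynomial (Fin n) K)) (β : ℕ → ℕ → ℕ) : Prop :=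
  ∃ F : MinimalGradedFreeResolution J, ∀ i j, F.betti i j = β i j

namespace MinimalGradedFreeResolution

theorem betti_ne_zero (F : MinimalGradedFreeResolution J) {i : ℕ} (b : F.B i) :
    F.betti i (F.deg i b) ≠ 0 := by
  have := F.finite i
  have : Nonempty {c : F.B i // F.deg i c = F.deg i b} := ⟨b, rfl⟩
  exact Nat.card_pos.ne'

/-- The index sets of the bases of the shifted resolution `⋯ → G₁ → G₀ → S → S/L → 0`. -/
def quotientB (G : MinimalGradedFreeResolution L) : ℕ → Type
  | 0 => Unit
  | i + 1 => G.B i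

/-- The degrees of the basis elements in the resolution of `(S/L)(-d)`. -/
def quotientDeg (G : MinimalGradedFreeResolution L) (d : ℕ) : ∀ i, G.quotientB i → ℕ
  | 0, _ => d
  | i + 1, b => d + G.deg i b

/-- The differentials of the resolution of `(S/L)(-d)`. -/
noncomputable def quotientD (G : MinimalGradedFreeResolution L) :
    ∀ i, (G.quotientB (i + 1) →₀ MvPolynomial (Fin n) K) →ₗ[MvPolynomial (Fin n) K]
      (G.quotientB i →₀ MvPolynomial (Fin n) K)
  | 0 => G.augmentation
  | i + 1 => G.d i

/-- The index of the generator `1` of `S/L`. -/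
def quotientGen (G : MinimalGradedFreeResolution L) : G.quotientB 0 := ()

instance (G : MinimalGradedFreeResolution L) : Unique (G.quotientB 0) :=
  inferInstanceAs (Unique Unit)

theorem quotientD_zero_apply (G : MinimalGradedFreeResolution L)
    (y : G.quotientB 1 →₀ MvPolynomial (Fin n) K) (a : G.quotientB 0) :
    G.quotientD 0 y a = G.ε y :=
  Finsupp.single_eq_same

theorem finite_quotientB (G : MinimalGradedFreeResolution L) : ∀ i, Finite (G.quotientB i)
  | 0 => inferInstanceAs (Finite Unit)
  | i + 1 => G.finite i

theorem isGradedMap_quotientD (G : MinimalGradedFreeResolution L) (d : ℕ) (i : ℕ) :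
    IsGradedMap (G.quotientDeg d (i + 1)) (G.quotientDeg d i) (G.quotientD i) := by
  cases i with
  | zero =>
    intro b a s hs
    have : 0 + s.degree = G.deg 0 b := G.isGradedMap_augmentation b a s hs
    simp only [quotientDeg] at this ⊢
    omega
  | succ i =>
    intro b a s hs
    have := G.d_homogeneous i b a s hs
    simp only [quotientDeg]
    omega

theorem exact_quotientD (G : MinimalGradedFreeResolution L) (i : ℕ) :
    Function.Exact (G.quotientD (i + 1)) (G.quotientD i) := by
  cases i with
  | zero => exact LinearMap.exact_iff.2 G.range_d_zero.symm
  | succ i => exact G.exact_succ i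

theorem constantCoeff_of_mem_range_quotientD (G : MinimalGradedFreeResolution L)
    (hL : ∀ f ∈ L, constantCoeff f = 0) {i : ℕ}
    {x : G.quotientB i →₀ MvPolynomial (Fin n) K} (hx : x ∈ LinearMap.range (G.quotientD i))
    (a : G.quotientB i) : constantCoeff (x a) = 0 := by
  cases i with
  | zero =>
    obtain ⟨y, rfl⟩ := hx
    rw [G.quotientD_zero_apply]
    exact hL _ (G.ε_mem y)
  | succ i => exact G.constantCoeff_of_mem_range hx a

theorem exists_quotient_comparison (F : MinimalGradedFreeResolution J)
    (G : MinimalGradedFreeResolution L) {u : MvPolynomial (Fin n) K} {d : ℕ}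
    (hu : ∀ s ∈ u.support, s.degree = d) (h : ∀ f ∈ L, f * u ∈ J) :
    ∃ c : ∀ i, (G.quotientB (i + 1) →₀ MvPolynomial (Fin n) K) →ₗ[MvPolynomial (Fin n) K]
        (F.B i →₀ MvPolynomial (Fin n) K),
      (∀ i, IsGradedMap (G.quotientDeg d (i + 1)) (F.deg i) (c i)) ∧
      (∀ x, F.ε (c 0 x) = -(u * G.quotientD 0 x G.quotientGen)) ∧
      ∀ i x, F.d i (c (i + 1) x) = -c i (G.quotientD (i + 1) x) := by
  obtain ⟨c, hc, h0, hs⟩ := F.exists_comparison G hu h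
  refine ⟨c, hc, fun x => ?_, hs⟩
  rw [G.quotientD_zero_apply]
  exact h0 x

theorem card_quotientDeg_zero (G : MinimalGradedFreeResolution L) (d j : ℕ) :
    Nat.card {b // G.quotientDeg d 0 b = j} = if j = d then 1 else 0 := by
  split_ifs with h
  · subst h
    exact (Nat.card_congr (Equiv.subtypeUnivEquiv fun _ => rfl)).trans Nat.card_unique
  · have : IsEmpty {b // G.quotientDeg d 0 b = j} := ⟨fun b => h b.2.symm⟩
    exact Nat.card_of_isEmpty

theorem card_quotientDeg_succ (G : MinimalGradedFreeResolution L) (d i j : ℕ) :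
    Nat.card {b // G.quotientDeg d (i + 1) b = j} = if d ≤ j then G.betti i (j - d) else 0 := by
  split_ifs with h
  · refine Nat.card_congr (Equiv.subtypeEquivRight fun b => ?_)
    simp only [quotientDeg]
    omega
  · have : IsEmpty {b // G.quotientDeg d (i + 1) b = j} :=
      ⟨fun b => h (le_of_le_of_eq (Nat.le_add_right _ _) b.2)⟩
    exact Nat.card_of_isEmpty

end MinimalGradedFreeResolution

/-- The map `(x, y) ↦ (f x + c y, g y)` between free modules on disjoint unions. -/
noncomputable def coneMap {B B' C C' : Type*}
    (f : (B →₀ MvPolynomial (Fin n) K) →ₗ[MvPolynomial (Fin n) K] (B' →₀ MvPolynomial (Fin n) K))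
    (g : (C →₀ MvPolynomial (Fin n) K) →ₗ[MvPolynomial (Fin n) K] (C' →₀ MvPolynomial (Fin n) K))
    (c : (C →₀ MvPolynomial (Fin n) K) →ₗ[MvPolynomial (Fin n) K] (B' →₀ MvPolynomial (Fin n) K)) :
    (B ⊕ C →₀ MvPolynomial (Fin n) K) →ₗ[MvPolynomial (Fin n) K]
      (B' ⊕ C' →₀ MvPolynomial (Fin n) K) :=
  (Finsupp.sumFinsuppLEquivProdFinsupp (MvPolynomial (Fin n) K)).symm.toLinearMap ∘ₗ
    ((f ∘ₗ LinearMap.fst _ _ _ + c ∘ₗ LinearMap.snd _ _ _).prod (g ∘ₗ LinearMap.snd _ _ _)) ∘ₗ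
    (Finsupp.sumFinsuppLEquivProdFinsupp (MvPolynomial (Fin n) K)).toLinearMap

/-- The vector `(x, y)` in the free module on a disjoint union. -/
noncomputable def pairVector {B C : Type*} (x : B →₀ MvPolynomial (Fin n) K)
    (y : C →₀ MvPolynomial (Fin n) K) : B ⊕ C →₀ MvPolynomial (Fin n) K :=
  (Finsupp.sumFinsuppLEquivProdFinsupp (MvPolynomial (Fin n) K)).symm (x, y)

section PairVector

variable {B B' B'' C C' C'' : Type*}

theorem exists_pairVector (v : B ⊕ C →₀ MvPolynomial (Fin n) K) : ∃ x y, v = pairVector x y :=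
  ⟨_, _, ((Finsupp.sumFinsuppLEquivProdFinsupp (MvPolynomial (Fin n) K)).symm_apply_apply v).symm⟩

@[simp] theorem pairVector_inl (x : B →₀ MvPolynomial (Fin n) K)
    (y : C →₀ MvPolynomial (Fin n) K) (b : B) : pairVector x y (Sum.inl b) = x b := by
  simp [pairVector]

@[simp] theorem pairVector_inr (x : B →₀ MvPolynomial (Fin n) K)
    (y : C →₀ MvPolynomial (Fin n) K) (c : C) : pairVector x y (Sum.inr c) = y c := by
  simp [pairVector]

theorem single_inl (b : B) :
    (Finsupp.single (Sum.inl b) 1 : B ⊕ C →₀ MvPolynomial (Fin n) K) =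
      pairVector (Finsupp.single b 1) 0 := by
  classical
  ext (a | a) : 1 <;> simp [Finsupp.single_apply]

theorem single_inr (c : C) :
    (Finsupp.single (Sum.inr c) 1 : B ⊕ C →₀ MvPolynomial (Fin n) K) =
      pairVector 0 (Finsupp.single c 1) := by
  classical
  ext (a | a) : 1 <;> simp [Finsupp.single_apply]

theorem pairVector_inj {x x' : B →₀ MvPolynomial (Fin n) K}
    {y y' : C →₀ MvPolynomial (Fin n) K} :
    pairVector x y = pairVector x' y' ↔ x = x' ∧ y = y' := by
  rw [pairVector, pairVector, EmbeddingLike.apply_eq_iff_eq, Prod.mk_inj]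

theorem pairVector_eq_zero {x : B →₀ MvPolynomial (Fin n) K}
    {y : C →₀ MvPolynomial (Fin n) K} : pairVector x y = 0 ↔ x = 0 ∧ y = 0 := by
  rw [pairVector, EmbeddingLike.map_eq_zero_iff, Prod.mk_eq_zero]

theorem isHomogeneousVector_pairVector {degB : B → ℕ} {degC : C → ℕ} {j : ℕ}
    {x : B →₀ MvPolynomial (Fin n) K} {y : C →₀ MvPolynomial (Fin n) K}
    (hx : IsHomogeneousVector degB j x) (hy : IsHomogeneousVector degC j y) :
    IsHomogeneousVector (Sum.elim degB degC) j (pairVector x y) := by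
  rintro (a | a) s hs
  · exact hx a s (by simpa using hs)
  · exact hy a s (by simpa using hs)

variable
  {f : (B →₀ MvPolynomial (Fin n) K) →ₗ[MvPolynomial (Fin n) K] (B' →₀ MvPolynomial (Fin n) K)}
  {f' : (B' →₀ MvPolynomial (Fin n) K) →ₗ[MvPolynomial (Fin n) K] (B'' →₀ MvPolynomial (Fin n) K)}
  {g : (C →₀ MvPolynomial (Fin n) K) →ₗ[MvPolynomial (Fin n) K] (C' →₀ MvPolynomial (Fin n) K)}
  {g' : (C' →₀ MvPolynomial (Fin n) K) →ₗ[MvPolynomial (Fin n) K] (C'' →₀ MvPolynomial (Fin n) K)}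
  {c : (C →₀ MvPolynomial (Fin n) K) →ₗ[MvPolynomial (Fin n) K] (B' →₀ MvPolynomial (Fin n) K)}
  {c' : (C' →₀ MvPolynomial (Fin n) K) →ₗ[MvPolynomial (Fin n) K] (B'' →₀ MvPolynomial (Fin n) K)}

theorem coneMap_pairVector (x : B →₀ MvPolynomial (Fin n) K) (y : C →₀ MvPolynomial (Fin n) K) :
    coneMap f g c (pairVector x y) = pairVector (f x + c y) (g y) := by
  simp [coneMap, pairVector]

theorem isGradedMap_coneMap {degB : B → ℕ} {degB' : B' → ℕ} {degC : C → ℕ} {degC' : C' → ℕ}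
    (hf : IsGradedMap degB degB' f) (hg : IsGradedMap degC degC' g)
    (hc : IsGradedMap degC degB' c) :
    IsGradedMap (Sum.elim degB degC) (Sum.elim degB' degC') (coneMap f g c) := by
  rintro (b | b)
  · rw [single_inl, coneMap_pairVector, map_zero, map_zero, add_zero]
    exact isHomogeneousVector_pairVector (hf b) (isHomogeneousVector_zero _ _)
  · rw [single_inr, coneMap_pairVector, map_zero, zero_add]
    exact isHomogeneousVector_pairVector (hc b) (hg b)

/-- The usual diagram chase: lift the second coordinate first, then correct the first by `c`. With
`c` anticommuting with the differentials, the cone itself needs no signs. -/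
theorem exact_coneMap (hf : Function.Exact f f') (hg : Function.Exact g g')
    (hc : ∀ y, f' (c y) = -c' (g y)) :
    Function.Exact (coneMap f g c) (coneMap f' g' c') := by
  intro v
  obtain ⟨x, y, rfl⟩ := exists_pairVector v
  rw [coneMap_pairVector, pairVector_eq_zero]
  constructor
  · rintro ⟨h1, h2⟩
    obtain ⟨y, rfl⟩ := (hg y).1 h2
    obtain ⟨x', hx'⟩ := (hf (x - c y)).1 (by rw [map_sub, hc, sub_neg_eq_add, h1])
    refine ⟨pairVector x' y, ?_⟩
    rw [coneMap_pairVector, hx', sub_add_cancel]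
  · rintro ⟨w, hw⟩
    obtain ⟨x', y', rfl⟩ := exists_pairVector w
    rw [coneMap_pairVector, pairVector_inj] at hw
    obtain ⟨rfl, rfl⟩ := hw
    exact ⟨by rw [map_add, hf.apply_apply_eq_zero, hc, zero_add, neg_add_cancel],
      hg.apply_apply_eq_zero _⟩

end PairVector

/-- The mapping cone: if `F` resolves `J`, `G` resolves `L = J : u`, and no degrees of basis
elements match, then the mapping cone is a minimal resolution of `J + (u)`. -/
theorem HasBettiNumbers.sup_span_singleton {β γ : ℕ → ℕ → ℕ} (hJ : HasBettiNumbers J β)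
    (hL : HasBettiNumbers L γ) {u : MvPolynomial (Fin n) K} {d : ℕ}
    (hu : ∀ s ∈ u.support, s.degree = d) (hcolon : ∀ f, f * u ∈ J ↔ f ∈ L)
    (hL0 : ∀ f ∈ L, constantCoeff f = 0) (hdeg : ∀ i j, β i (d + j) = 0 ∨ γ i j = 0) :
    HasBettiNumbers (J ⊔ Ideal.span {u}) fun i j => β i j +
      match i with
      | 0 => if j = d then 1 else 0
      | i + 1 => if d ≤ j then γ i (j - d) else 0 := by
  obtain ⟨F, hF⟩ := hJ
  obtain ⟨G, hG⟩ := hL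
  obtain ⟨c, hc, hc0, hcs⟩ := F.exists_quotient_comparison G hu fun f => (hcolon f).2
  let ε : (F.B 0 ⊕ G.quotientB 0 →₀ MvPolynomial (Fin n) K) →ₗ[MvPolynomial (Fin n) K]
      MvPolynomial (Fin n) K :=
    (F.ε ∘ₗ LinearMap.fst _ _ _ + (u • Finsupp.lapply (R := MvPolynomial (Fin n) K) G.quotientGen) ∘ₗ
      LinearMap.snd _ _ _) ∘ₗ
      (Finsupp.sumFinsuppLEquivProdFinsupp (MvPolynomial (Fin n) K)).toLinearMap
  have hε : ∀ x y, ε (pairVector x y) = F.ε x + u * y G.quotientGen := by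
    intro x y
    simp [ε, pairVector]
  let H : MinimalGradedFreeResolution (J ⊔ Ideal.span {u}) :=
    { B := fun i => F.B i ⊕ G.quotientB i
      finite := fun i => by
        have := F.finite i
        have := G.finite_quotientB i
        infer_instance
      deg := fun i => Sum.elim (F.deg i) (G.quotientDeg d i)
      d := fun i => coneMap (F.d i) (G.quotientD i) (c i)
      ε := ε
      ε_homogeneous := by
        rintro (b | b)
        · rw [single_inl, hε]
          simpa using F.ε_homogeneous b
        · rw [single_inr, hε, map_zero, zero_add]
          intro s hs
          have hs' : s ∈ u.support := by
            rw [mem_support_iff]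
            refine fun h0 => hs ?_
            rw [Unique.eq_default b, Unique.eq_default G.quotientGen, Finsupp.single_eq_same, mul_one]
            exact h0
          have := hu s hs'
          rw [Finsupp.degree_eq_weight_one] at this
          exact this
      d_homogeneous := fun i => isGradedMap_coneMap (F.isGradedMap_d i)
        (G.isGradedMap_quotientD d i) (hc i)
      range_ε := by
        ext f
        rw [Submodule.mem_sup]
        constructor
        · rintro ⟨v, rfl⟩
          obtain ⟨x, y, rfl⟩ := exists_pairVector v
          refine ⟨F.ε x, F.ε_mem x, u * y G.quotientGen, ?_, (hε x y).symm⟩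
          exact Ideal.mul_mem_right _ _ (Ideal.mem_span_singleton_self u)
        · rintro ⟨g, hg, h, hh, rfl⟩
          obtain ⟨x, rfl⟩ := F.mem_range_ε_iff.2 hg
          obtain ⟨y, rfl⟩ := Ideal.mem_span_singleton'.1 hh
          refine ⟨pairVector x (Finsupp.single G.quotientGen y), ?_⟩
          rw [hε, Finsupp.single_eq_same, mul_comm]
      exact_zero := by
        intro v
        obtain ⟨x, y, rfl⟩ := exists_pairVector v
        rw [hε]
        constructor
        · intro h
          -- A relation `ε x + u y = 0` says `u y ∈ J`, that is, `y` lies in the colon ideal `L`.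
          -- Hence `y` lifts through `G`.
          have hy : y G.quotientGen ∈ L := by
            rw [← hcolon, mul_comm, ← F.range_ε]
            exact ⟨-x, by rw [map_neg]; exact neg_eq_of_add_eq_zero_right h⟩
          obtain ⟨y', hy'⟩ : ∃ y', G.quotientD 0 y' G.quotientGen = y G.quotientGen := by
            obtain ⟨y', hy'⟩ := G.mem_range_ε_iff.2 hy
            exact ⟨y', (G.quotientD_zero_apply y' _).trans hy'⟩
          obtain ⟨x', hx'⟩ := (F.exact_zero (x - c 0 y')).1 (by
            rw [map_sub, hc0, sub_neg_eq_add, hy', h])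
          refine ⟨pairVector x' y', ?_⟩
          rw [coneMap_pairVector, hx', pairVector_inj]
          refine ⟨sub_add_cancel _ _, ?_⟩
          refine Finsupp.ext fun a => ?_
          rw [Subsingleton.elim a G.quotientGen, hy']
        · rintro ⟨w, hw⟩
          obtain ⟨x', y', rfl⟩ := exists_pairVector w
          rw [coneMap_pairVector, pairVector_inj] at hw
          obtain ⟨rfl, rfl⟩ := hw
          rw [map_add, hc0, F.exact_zero.apply_apply_eq_zero, zero_add, neg_add_cancel]
      exact_succ := fun i => exact_coneMap (F.exact_succ i) (G.exact_quotientD i) (hcs i)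
      minimal := by
        rintro i _ ⟨v, rfl⟩
        obtain ⟨x, y, rfl⟩ := exists_pairVector v
        rw [coneMap_pairVector, mem_irrelevant_smul_top_iff]
        rintro (a | a)
        · rw [pairVector_inl, Finsupp.add_apply, map_add,
            F.constantCoeff_of_mem_range ⟨x, rfl⟩, zero_add]
          have := G.finite_quotientB (i + 1)
          have := Fintype.ofFinite (G.quotientB (i + 1))
          rw [apply_eq_sum_mul, map_sum]
          refine Finset.sum_eq_zero fun b _ => ?_
          rw [map_mul, (hc i).constantCoeff_eq_zero, mul_zero]
          intro hab
          -- A constant entry of `c i` could only join basis elements of equal degree, and `hdeg`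
          -- excludes such a pair.
          rcases hdeg i (G.deg i b) with h | h
          · refine F.betti_ne_zero a ?_
            rw [hF, hab]
            exact h
          · exact G.betti_ne_zero b ((hG i _).trans h)
        · rw [pairVector_inr]
          exact G.constantCoeff_of_mem_range_quotientD hL0 ⟨y, rfl⟩ a }
  refine ⟨H, fun i j => ?_⟩
  have := F.finite i
  have := G.finite_quotientB i
  have hcard : H.betti i j = F.betti i j + Nat.card {b // G.quotientDeg d i b = j} := by
    rw [MinimalGradedFreeResolution.betti, Nat.card_congr Equiv.subtypeSum, Nat.card_sum]
    rfl
  rw [hcard, hF]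
  cases i with
  | zero => rw [G.card_quotientDeg_zero]
  | succ i => rw [G.card_quotientDeg_succ, hG]

end MappingCone

/-! ### Ideals generated by variables. -/

section LinearQuotients

variable {K : Type*} [Field K] {n : ℕ}

theorem hasBettiNumbers_bot :
    HasBettiNumbers (⊥ : Ideal (MvPolynomial (Fin n) K)) fun _ _ => 0 := by
  refine ⟨{ B := fun _ => Empty
            finite := fun _ => inferInstance
            deg := fun _ b => b.elim
            d := fun _ => 0
            ε := 0
            ε_homogeneous := fun b => b.elim
            d_homogeneous := fun _ b => b.elim
            range_ε := LinearMap.range_zero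
            exact_zero := fun x => by simp [Subsingleton.elim x 0]
            exact_succ := fun i x => by simp [Subsingleton.elim x 0]
            minimal := fun i => by simp }, fun i j => ?_⟩
  have : IsEmpty {b : Empty // (fun b : Empty => (b.elim : ℕ)) b = j} := ⟨fun b => b.1.elim⟩
  exact Nat.card_of_isEmpty

theorem forall_mem_support_mul_monomial_iff {f : MvPolynomial (Fin n) K} {u : Fin n →₀ ℕ}
    {P : (Fin n →₀ ℕ) → Prop} :
    (∀ c ∈ (f * monomial u 1).support, P c) ↔ ∀ c ∈ f.support, P (c + u) := by
  constructor
  · intro h c hc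
    refine h _ ?_
    rw [mem_support_iff, coeff_mul_monomial, mul_one]
    exact mem_support_iff.1 hc
  · intro h c hc
    rw [mem_support_iff, coeff_mul_monomial'] at hc
    split_ifs at hc with hle
    · rw [← tsub_add_cancel_of_le hle]
      exact h _ (mem_support_iff.2 (by simpa using hc))
    · exact absurd rfl hc

theorem constantCoeff_eq_zero_of_mem_span_X {T : Set (Fin n)} {f : MvPolynomial (Fin n) K}
    (hf : f ∈ Ideal.span ((X : Fin n → MvPolynomial (Fin n) K) '' T)) : constantCoeff f = 0 :=
  mem_span_range_X_iff.1 (Ideal.span_mono (Set.image_subset_range _ _) hf)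

/-- The Betti numbers of an ideal generated by variables. -/
theorem hasBettiNumbers_span_X (T : Finset (Fin n)) :
    HasBettiNumbers (Ideal.span ((X : Fin n → MvPolynomial (Fin n) K) '' T))
      fun i j => if j = i + 1 then T.card.choose (i + 1) else 0 := by
  classical
  induction T using Finset.induction_on with
  | empty => simpa using hasBettiNumbers_bot
  | insert a T ha ih =>
    have hdeg : ∀ s ∈ (X a : MvPolynomial (Fin n) K).support, s.degree = 1 := by
      intro s hs
      rw [support_X, Finset.mem_singleton] at hs
      simp [hs]
    have hcolon : ∀ f, f * X a ∈ Ideal.span ((X : Fin n → MvPolynomial (Fin n) K) '' T) ↔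
        f ∈ Ideal.span ((X : Fin n → MvPolynomial (Fin n) K) '' T) := by
      intro f
      rw [mem_ideal_span_X_image, mem_ideal_span_X_image, X,
        forall_mem_support_mul_monomial_iff]
      refine forall₂_congr fun c _ => exists_congr fun i => and_congr_right fun hi => ?_
      have : a ≠ i := fun h => ha (h ▸ hi)
      simp [this]
    -- A new variable is regular modulo the others, so the colon ideal is the ideal itself. Its
    -- `i`-th syzygies sit in degree `i + 1` and the shifted ones in degree `i + 2`, so nothing
    -- cancels. The counts obey Pascal's rule.
    have h := ih.sup_span_singleton ih hdeg hcolon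
      (fun f hf => constantCoeff_eq_zero_of_mem_span_X hf) (fun i j => by
        by_cases hj : j = i + 1
        · left; rw [if_neg (by omega)]
        · right; rw [if_neg hj])
    convert h using 1
    · rw [Finset.coe_insert, Set.image_insert_eq, Set.insert_eq, Ideal.span_union, sup_comm]
    · funext i j
      rw [Finset.card_insert_of_notMem ha]
      cases i with
      | zero => by_cases hj : j = 1 <;> simp [hj]
      | succ i =>
        by_cases hj : j = i + 2
        · subst hj
          simp [Nat.choose_succ_succ' T.card (i + 1), add_comm (T.card.choose (i + 1))]
        · have h1 : ¬ (1 ≤ j ∧ j - 1 = i + 1) := by omega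
          simp only [← ite_and, h1, if_false]
          rw [if_neg hj, if_neg hj]

end LinearQuotients

/-! ### Combinatorics of index lists and the colon ideals. -/

section Lists

/-- The exponent vector in `n` variables of the monomial `∏_{i ∈ L} x_i`. -/
noncomputable def listExponent (n : ℕ) (L : List ℕ) : Fin n →₀ ℕ :=
  Finsupp.equivFunOnFinite.symm fun i => L.count i.val

@[simp] theorem listExponent_apply (n : ℕ) (L : List ℕ) (i : Fin n) :
    listExponent n L i = L.count i.val := rfl

theorem degree_listExponent {n : ℕ} {L : List ℕ} (hL : ∀ x ∈ L, x < n) :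
    (listExponent n L).degree = L.length := by
  rw [Finsupp.degree_eq_sum]
  simp only [listExponent_apply]
  rw [Fin.sum_univ_eq_sum_range (fun i => L.count i) n]
  simpa using Multiset.sum_count_eq_card (s := Finset.range n) (m := (L : Multiset ℕ))
    (fun a ha => Finset.mem_range.2 (hL a ha))

theorem listExponent_le_of_prefix {n : ℕ} {L M : List ℕ} (h : L <+: M) :
    listExponent n L ≤ listExponent n M :=
  fun i => h.sublist.count_le i.val

/-- The indices `i` for which `x_i` multiplies the `t`-spread monomial `u` into the ideal of
its predecessors: those in the gaps `[a, u₁)`, `[u₁ + t, u₂)`, `[u₂ + t, u₃)`, …. -/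
def gapSet (t : ℕ) : ℕ → List ℕ → Finset ℕ
  | _, [] => ∅
  | a, b :: l => Finset.Ico a b ∪ gapSet t (b + t) l

/-- The number of elements of `gapSet`. -/
def gapCount (t : ℕ) : ℕ → List ℕ → ℕ
  | _, [] => 0
  | a, b :: l => (b - a) + gapCount t (b + t) l

theorem mem_gapSet_of_append {t a i b : ℕ} {p l : List ℕ} (ha : a ≤ i) (hp : ∀ x ∈ p, x + t ≤ i)
    (hb : i < b) : i ∈ gapSet t a (p ++ b :: l) := by
  induction p generalizing a with
  | nil => simp [gapSet, ha, hb]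
  | cons x p ih =>
    rw [List.cons_append, gapSet, Finset.mem_union]
    exact Or.inr (ih (hp x (by simp)) fun y hy => hp y (by simp [hy]))

theorem exists_append_of_mem_gapSet {t a i : ℕ} {u : List ℕ} (hu : u.Pairwise fun x y => x + t ≤ y)
    (ha : ∀ x ∈ u, a ≤ x) (hi : i ∈ gapSet t a u) :
    a ≤ i ∧ ∃ p b l, u = p ++ b :: l ∧ (∀ x ∈ p, x + t ≤ i) ∧ i < b := by
  induction u generalizing a with
  | nil => simp [gapSet] at hi
  | cons b l ih =>
    rw [gapSet, Finset.mem_union, Finset.mem_Ico] at hi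
    rcases hi with hi | hi
    · exact ⟨hi.1, [], b, l, rfl, by simp, hi.2⟩
    · rw [List.pairwise_cons] at hu
      obtain ⟨h1, p, c, l', rfl, h2, h3⟩ := ih hu.2 hu.1 hi
      have := ha b (by simp)
      refine ⟨by omega, b :: p, c, l', rfl, fun x hx => ?_, h3⟩
      rcases List.mem_cons.1 hx with rfl | hx
      · exact h1
      · exact h2 x hx

theorem card_gapSet {t a : ℕ} {u : List ℕ} (hu : u.Pairwise fun x y => x + t ≤ y)
    (ha : ∀ x ∈ u, a ≤ x) : (gapSet t a u).card = gapCount t a u := by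
  induction u generalizing a with
  | nil => rfl
  | cons b l ih =>
    rw [List.pairwise_cons] at hu
    rw [gapSet, gapCount, Finset.card_union_of_disjoint, Nat.card_Ico, ih hu.2 hu.1]
    rw [Finset.disjoint_left]
    intro i hi hi'
    have := (exists_append_of_mem_gapSet hu.2 hu.1 hi').1
    have := (Finset.mem_Ico.1 hi).2
    omega

theorem eq_of_forall₂_le_of_sum_le {u v : List ℕ} (h : List.Forall₂ (· ≤ ·) u v)
    (hs : v.sum ≤ u.sum) : u = v := by
  have hle : ∀ {u v : List ℕ}, List.Forall₂ (· ≤ ·) u v → u.sum ≤ v.sum :=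
    fun h => List.Forall₂.sum_le_sum h
  induction h with
  | nil => rfl
  | cons hab h ih =>
    have := hle h
    simp only [List.sum_cons] at hs
    rw [ih (by omega)]
    congr 1
    omega

/-- Either `u₁ ≤ v₁, u₂ ≤ v₂, …` or there is a first position with `v_s < u_s`. -/
theorem forall₂_take_or_exists_lt (u v : List ℕ) (h : v.length ≤ u.length) :
    List.Forall₂ (· ≤ ·) (u.take v.length) v ∨
      ∃ p b l q a l', u = p ++ b :: l ∧ v = q ++ a :: l' ∧ List.Forall₂ (· ≤ ·) p q ∧ a < b := by
  induction v generalizing u with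
  | nil => left; simp
  | cons a v ih =>
    cases u with
    | nil => simp at h
    | cons b u =>
      rcases lt_or_ge a b with hab | hab
      · exact Or.inr ⟨[], b, u, [], a, v, rfl, rfl, .nil, hab⟩
      · rcases ih u (by simpa using h) with h | ⟨p, c, l, q, d, l', rfl, rfl, h1, h2⟩
        · left
          exact .cons hab h
        · exact Or.inr ⟨b :: p, c, l, a :: q, d, l', rfl, rfl, .cons hab h1, h2⟩

/-- An entry `a` of `p` forces the corresponding entry of `q` to be `a`, because it lies between `a`
and the bound `a`. -/
theorem count_le_count_of_forall₂ {a : ℕ} {p q : List ℕ} (h : List.Forall₂ (· ≤ ·) p q)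
    (hq : ∀ x ∈ q, x ≤ a) : p.count a ≤ q.count a := by
  induction h with
  | nil => simp
  | @cons x y p q hxy h ih =>
    have := ih fun z hz => hq z (by simp [hz])
    have hy := hq y (by simp)
    rw [List.count_cons, List.count_cons]
    by_cases hx : x = a
    · have : y = a := by omega
      simp only [hx, this, beq_self_eq_true, if_true]
      omega
    · simp only [beq_iff_eq, hx, if_false]
      omega

theorem forall_mem_add_le_of_forall₂ {t a : ℕ} {p q : List ℕ} (h : List.Forall₂ (· ≤ ·) p q)
    (hq : ∀ x ∈ q, x + t ≤ a) : ∀ x ∈ p, x + t ≤ a := by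
  induction h with
  | nil => simp
  | @cons x y p q hxy h ih =>
    rw [List.forall_mem_cons] at hq ⊢
    exact ⟨by omega, ih hq.2⟩

/-- A family of index lists of `t`-spread monomials that behaves like the minimal generators of a
`t`-spread strongly stable ideal. -/
structure IsSpreadSystem (t : ℕ) (G : Set (List ℕ)) : Prop where
  spread : ∀ u ∈ G, u.Pairwise fun x y => x + t ≤ y
  exchange : ∀ p b l i, p ++ b :: l ∈ G → i < b → (∀ x ∈ p, x + t ≤ i) →
    ∃ w ∈ G, w <+: p ++ i :: l
  crossing : ∀ u ∈ G, ∀ v ∈ G, v.length < u.length →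
    ¬ List.Forall₂ (· ≤ ·) (u.take v.length) v

/-- `J : u = (x_i : i ∈ gapSet u)` on the level of monomials, where `J` is generated by the
predecessors of `u`. -/
theorem IsSpreadSystem.exists_le_add_iff {t m : ℕ} {G : Set (List ℕ)} (hG : IsSpreadSystem t G)
    (hm : ∀ u ∈ G, ∀ x ∈ u, x < m) {s : Set (List ℕ)} {u : List ℕ} (hs : s ⊆ G) (hu : u ∈ G)
    (hus : u ∉ s)
    (hle : ∀ w ∈ s, w.length < u.length ∨ w.length = u.length ∧ w.sum ≤ u.sum)
    (hlt : ∀ w ∈ G, w.length < u.length ∨ w.length = u.length ∧ w.sum < u.sum → w ∈ s)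
    (c : Fin m →₀ ℕ) :
    (∃ w ∈ s, listExponent m w ≤ c + listExponent m u) ↔
      ∃ i : Fin m, i.val ∈ gapSet t 0 u ∧ c i ≠ 0 := by
  constructor
  · rintro ⟨w, hw, hwc⟩
    rcases forall₂_take_or_exists_lt u w (by rcases hle w hw with h | h <;> omega) with
      h | ⟨p, b, l, q, a, l', rfl, rfl, hpq, hab⟩
    · exfalso
      -- No position has `w_s < u_s`. A shorter `w` contradicts `crossing`; for equal length, the
      -- bound on the sums forces `w = u`.
      rcases hle w hw with h1 | ⟨h1, h2⟩
      · exact hG.crossing u hu w (hs hw) h1 h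
      · rw [h1, List.take_length] at h
        exact hus (eq_of_forall₂_le_of_sum_le h h2 ▸ hw)
    · have hw' := hG.spread _ (hs hw)
      have hu' := hG.spread _ hu
      rw [List.pairwise_append, List.pairwise_cons] at hw' hu'
      have hq : ∀ x ∈ q, x + t ≤ a := fun x hx => hw'.2.2 x hx a (by simp)
      have hp : ∀ x ∈ p, x + t ≤ a :=
        forall_mem_add_le_of_forall₂ hpq hq
      have ham : a < m := hm _ (hs hw) a (by simp)
      -- At the first position with `w_s = a < b = u_s`, the index `a` is in a gap of `u`. The
      -- monomial `w` contains `x_a` more often than `u` does, since the tail of `u` exceeds `a`; so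
      -- `x_a` must divide the cofactor.
      refine ⟨⟨a, ham⟩, mem_gapSet_of_append (Nat.zero_le _) hp hab, ?_⟩
      have h1 := hwc ⟨a, ham⟩
      have h2 := count_le_count_of_forall₂ hpq (a := a) fun x hx => by
        have := hq x hx
        omega
      have h3 : l.count a = 0 := List.count_eq_zero.2 fun h => by
        have := hu'.2.1.1 a h
        omega
      simp only [listExponent_apply, Finsupp.add_apply, List.count_append,
        List.count_cons_self, List.count_cons_of_ne hab.ne', h3] at h1
      omega
  · rintro ⟨i, hi, hci⟩
    obtain ⟨-, p, b, l, rfl, hp, hb⟩ :=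
      exists_append_of_mem_gapSet (hG.spread u hu) (fun _ _ => Nat.zero_le _) hi
    -- Replacing `b` by `i` gives a divisor of `x_i u`. The generator that is a prefix of it is
    -- shorter than `u`, or has equal length and smaller index sum, so it is a predecessor.
    obtain ⟨w, hw, hwp⟩ := hG.exchange p b l i hu hb hp
    refine ⟨w, hlt w hw ?_, (listExponent_le_of_prefix hwp).trans fun k => ?_⟩
    · have hl := hwp.length_le
      simp only [List.length_append, List.length_cons] at hl ⊢
      rcases hl.lt_or_eq with h | h
      · exact Or.inl h
      · have : w = p ++ i.val :: l := hwp.eq_of_length (by simpa using h)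
        subst this
        refine Or.inr ⟨h, ?_⟩
        simp only [List.sum_append, List.sum_cons]
        omega
    · have h1 : c k ≥ if i.val = k.val then 1 else 0 := by
        split_ifs with h
        · rw [← Fin.ext h]; omega
        · omega
      simp only [listExponent_apply, Finsupp.add_apply, List.count_append, List.count_cons,
        beq_iff_eq]
      omega

theorem card_filter_mem_gapSet {t m : ℕ} {u : List ℕ} (hu : u.Pairwise fun x y => x + t ≤ y)
    (hm : ∀ x ∈ u, x < m) :
    (Finset.univ.filter fun i : Fin m => i.val ∈ gapSet t 0 u).card = gapCount t 0 u := by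
  rw [← card_gapSet hu fun _ _ => Nat.zero_le _, ← Finset.card_map Fin.valEmbedding]
  congr 1
  ext i
  simp only [Finset.mem_map, Finset.mem_filter, Finset.mem_univ, true_and, Fin.valEmbedding_apply]
  constructor
  · rintro ⟨k, hk, rfl⟩
    exact hk
  · intro hi
    obtain ⟨-, p, b, l, rfl, -, hb⟩ := exists_append_of_mem_gapSet hu (fun _ _ => Nat.zero_le _) hi
    exact ⟨⟨i, hb.trans (hm b (by simp))⟩, hi, rfl⟩

/-- The graded Betti numbers of the ideal generated by a spread system. -/
theorem IsSpreadSystem.hasBettiNumbers {K : Type*} [Field K] {t m : ℕ} {G : Finset (List ℕ)}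
    (hG : IsSpreadSystem t G) (hm : ∀ u ∈ G, ∀ x ∈ u, x < m) :
    HasBettiNumbers
      (Ideal.span ((fun c => monomial c (1 : K)) '' (listExponent m '' (G : Set (List ℕ)))))
      fun i j => ∑ u ∈ G, if j = u.length + i then (gapCount t 0 u).choose i else 0 := by
  classical
  -- The induction runs over subsets closed under passing to strictly smaller keys; ties in degree
  -- and index sum may be added in any order.
  suffices h : ∀ s : Finset (List ℕ), s ⊆ G →
      (∀ u ∈ s, ∀ v ∈ G, v.length < u.length ∨ v.length = u.length ∧ v.sum < u.sum → v ∈ s) →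
      HasBettiNumbers
        (Ideal.span ((fun c => monomial c (1 : K)) '' (listExponent m '' (s : Set (List ℕ)))))
        fun i j => ∑ u ∈ s, if j = u.length + i then (gapCount t 0 u).choose i else 0 from
    h G subset_rfl fun _ _ v hv _ => hv
  intro s
  induction s using Finset.induction_on_max_value
    (fun u : List ℕ => toLex (u.length, u.sum)) with
  | empty => intro _ _; simpa using hasBettiNumbers_bot
  | insert u s hus hmax ih =>
    intro hsG hlow
    have hu : u ∈ G := hsG (Finset.mem_insert_self _ _)
    have hs : s ⊆ G := (Finset.subset_insert _ _).trans hsG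
    have hle : ∀ w ∈ s, w.length < u.length ∨ w.length = u.length ∧ w.sum ≤ u.sum :=
      fun w hw => by simpa [Prod.Lex.toLex_le_toLex] using hmax w hw
    have hlt : ∀ w ∈ G, w.length < u.length ∨ w.length = u.length ∧ w.sum < u.sum → w ∈ s := by
      intro w hw h
      refine (Finset.mem_insert.1 (hlow u (Finset.mem_insert_self _ _) w hw h)).resolve_left ?_
      rintro rfl
      omega
    have hJ := ih hs fun w hw v hv h => by
      refine hlt v hv ?_
      have := hle w hw
      omega
    have hL := hasBettiNumbers_span_X (K := K)
      (Finset.univ.filter fun i : Fin m => i.val ∈ gapSet t 0 u)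
    rw [card_filter_mem_gapSet (hG.spread u hu) (hm u hu)] at hL
    have h := hJ.sup_span_singleton hL (u := monomial (listExponent m u) 1) (d := u.length)
      (fun c hc => by
        rw [Finset.mem_singleton.1 (support_monomial_subset hc), degree_listExponent (hm u hu)])
      (fun f => by
        rw [mem_ideal_span_monomial_image, forall_mem_support_mul_monomial_iff,
          mem_ideal_span_X_image]
        refine forall₂_congr fun c _ => ?_
        have := hG.exists_le_add_iff hm (s := s) (by exact_mod_cast hs) hu
          (by simpa using hus) hle (by simpa using hlt) c
        simpa using this)
      (fun f hf => constantCoeff_eq_zero_of_mem_span_X hf)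
      (fun i j => by
        -- Shifted by `u.length`, the colon ideal's `i`-th syzygies have degree `u.length + i + 1`,
        -- whereas those of the predecessors have degree at most `u.length + i`.
        by_cases hj : j = i + 1
        · left
          refine Finset.sum_eq_zero fun w hw => if_neg ?_
          have := hle w hw
          omega
        · right; rw [if_neg hj])
    convert h using 1
    · rw [Finset.coe_insert, Set.image_insert_eq, Set.image_insert_eq, Set.insert_eq,
        Ideal.span_union, sup_comm]
    · funext i j
      rw [Finset.sum_insert hus, add_comm]
      congr 1
      cases i with
      | zero => simp
      | succ i =>
        by_cases hj : j = u.length + (i + 1)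
        · subst hj
          simp
        · simp only [if_neg hj]
          split_ifs <;> first | rfl | omega

end Lists

/-! ### Stretching of index lists. -/

section Stretch

/-- `[b₀, b₁, b₂, …] ↦ [b₀ + k, b₁ + k + 1, b₂ + k + 2, …]`. -/
def stretchList : ℕ → List ℕ → List ℕ
  | _, [] => []
  | k, b :: l => (b + k) :: stretchList (k + 1) l

theorem mapIdx_add_eq_stretchList (k : ℕ) (L : List ℕ) :
    L.mapIdx (fun j i => i + (j + k)) = stretchList k L := by
  induction L generalizing k with
  | nil => rfl
  | cons b l ih =>
    rw [List.mapIdx_cons, stretchList, ← ih]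
    simp [add_assoc, add_comm 1 k]

@[simp] theorem length_stretchList (k : ℕ) (L : List ℕ) : (stretchList k L).length = L.length := by
  induction L generalizing k with
  | nil => rfl
  | cons b l ih => simp [stretchList, ih]

theorem stretchList_append (k : ℕ) (p q : List ℕ) :
    stretchList k (p ++ q) = stretchList k p ++ stretchList (k + p.length) q := by
  induction p generalizing k with
  | nil => rfl
  | cons b l ih => simp [stretchList, ih, add_assoc, add_comm 1]

theorem stretchList_injective (k : ℕ) : Function.Injective (stretchList k) := by
  intro L M h
  induction L generalizing k M with
  | nil => cases M <;> simp_all [stretchList]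
  | cons b l ih =>
    cases M with
    | nil => simp [stretchList] at h
    | cons c m =>
      simp only [stretchList, List.cons.injEq, Nat.add_right_cancel_iff] at h
      rw [h.1, ih _ h.2]

theorem stretchList_take (k j : ℕ) (L : List ℕ) :
    stretchList k (L.take j) = (stretchList k L).take j := by
  induction L generalizing k j with
  | nil => simp [stretchList]
  | cons b l ih => cases j <;> simp [stretchList, ih]

theorem forall₂_stretchList_iff (k : ℕ) {L M : List ℕ} :
    List.Forall₂ (· ≤ ·) (stretchList k L) (stretchList k M) ↔ List.Forall₂ (· ≤ ·) L M := by
  induction L generalizing k M with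
  | nil => cases M <;> simp [stretchList]
  | cons b l ih => cases M <;> simp [stretchList, ih]

theorem exists_append_of_stretchList_eq {k : ℕ} {u p q : List ℕ} {b : ℕ}
    (h : stretchList k u = p ++ b :: q) :
    ∃ p' b' q', u = p' ++ b' :: q' ∧ p = stretchList k p' ∧ b = b' + (k + p'.length) ∧
      q = stretchList (k + p'.length + 1) q' := by
  induction p generalizing k u with
  | nil =>
    cases u with
    | nil => simp [stretchList] at h
    | cons c u =>
      simp only [stretchList, List.nil_append, List.cons.injEq] at h
      exact ⟨[], c, u, rfl, rfl, h.1.symm, h.2.symm⟩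
  | cons a p ih =>
    cases u with
    | nil => simp [stretchList] at h
    | cons c u =>
      simp only [stretchList, List.cons_append, List.cons.injEq] at h
      obtain ⟨p', b', q', rfl, rfl, rfl, rfl⟩ := ih h.2
      refine ⟨c :: p', b', q', rfl, ?_, ?_, ?_⟩
      · rw [stretchList, h.1]
      · simp only [List.length_cons]; omega
      · rw [List.length_cons]; congr 1; omega

theorem exists_mem_of_mem_stretchList {k x : ℕ} {L : List ℕ} (h : x ∈ stretchList k L) :
    ∃ y ∈ L, y + k ≤ x := by
  induction L generalizing k with
  | nil => simp [stretchList] at h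
  | cons b l ih =>
    rcases List.mem_cons.1 h with rfl | h
    · exact ⟨b, by simp, le_rfl⟩
    · obtain ⟨y, hy, hyx⟩ := ih h
      exact ⟨y, by simp [hy], by omega⟩

theorem pairwise_stretchList {t : ℕ} (k : ℕ) {L : List ℕ}
    (h : L.Pairwise fun x y => x + t ≤ y) :
    (stretchList k L).Pairwise fun x y => x + (t + 1) ≤ y := by
  induction L generalizing k with
  | nil => simp [stretchList]
  | cons b l ih =>
    rw [List.pairwise_cons] at h
    rw [stretchList, List.pairwise_cons]
    refine ⟨fun x hx => ?_, ih _ h.2⟩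
    obtain ⟨y, hy, hyx⟩ := exists_mem_of_mem_stretchList hx
    have := h.1 y hy
    omega

/-- The last entry of `p` is shifted by `k + p.length - 1`; the extra one in `t + 1` completes this
to `k + p.length`. Earlier entries are no larger, so they inherit the bound. Thus an index allowed
after the stretched prefix can be shifted back to one allowed after `p`. -/
theorem add_le_of_forall_mem_stretchList {t k i : ℕ} {p : List ℕ}
    (hp : p.Pairwise fun x y => x + t ≤ y) (h : ∀ x ∈ stretchList k p, x + (t + 1) ≤ i) :
    ∀ x ∈ p, x + t + (k + p.length) ≤ i := by
  induction p generalizing k with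
  | nil => simp
  | cons b l ih =>
    rw [List.pairwise_cons] at hp
    rw [stretchList, List.forall_mem_cons] at h
    have hl := ih hp.2 h.2
    rw [List.forall_mem_cons, List.length_cons]
    refine ⟨?_, fun x hx => by have := hl x hx; omega⟩
    cases l with
    | nil => simp only [List.length_nil]; omega
    | cons c l =>
      have h1 := hp.1 c (by simp)
      have h2 := hl c (by simp)
      omega

/-- Both endpoints of each gap move by the same amount: the lower one gains the extra unit of
spacing, the upper one the extra unit of shift. -/
theorem gapCount_stretchList (t k a : ℕ) (u : List ℕ) :
    gapCount (t + 1) (a + k) (stretchList k u) = gapCount t a u := by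
  induction u generalizing k a with
  | nil => rfl
  | cons b l ih =>
    rw [stretchList, gapCount, gapCount, ← ih (k + 1) (b + t),
      show b + k + (t + 1) = b + t + (k + 1) by omega, Nat.add_sub_add_right]

/-- Stretching adds to each entry an amount depending only on its position. It therefore respects
prefixes, truncation and entrywise comparison, and an exchange at one position can be undone,
performed and stretched again. -/
theorem IsSpreadSystem.stretch {t : ℕ} {G : Set (List ℕ)} (hG : IsSpreadSystem t G) :
    IsSpreadSystem (t + 1) (stretchList 0 '' G) where
  spread := by
    rintro _ ⟨u, hu, rfl⟩
    exact pairwise_stretchList 0 (hG.spread u hu)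
  exchange := by
    rintro p b l i ⟨u, hu, h⟩ hib hp
    obtain ⟨p', b', l', rfl, rfl, rfl, rfl⟩ := exists_append_of_stretchList_eq h
    have h1 := add_le_of_forall_mem_stretchList (List.pairwise_append.1 (hG.spread _ hu)).1 hp
    have hlen : p'.length ≤ i := by
      cases p' with
      | nil => simp
      | cons x p' => have := h1 x (by simp); omega
    -- The index `i` stands at position `p'.length`, so its unstretched value is `i - p'.length`;
    -- `hlen` makes this a genuine subtraction.
    obtain ⟨w, hw, r, hr⟩ := hG.exchange p' b' l' (i - p'.length) hu (by omega) fun x hx => by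
      have := h1 x hx
      omega
    refine ⟨_, ⟨w, hw, rfl⟩, stretchList (0 + w.length) r, ?_⟩
    rw [← stretchList_append, hr, stretchList_append, stretchList]
    congr 2
    omega
  crossing := by
    rintro _ ⟨u, hu, rfl⟩ _ ⟨v, hv, rfl⟩ hlen h
    simp only [length_stretchList] at hlen h
    rw [← stretchList_take, forall₂_stretchList_iff] at h
    exact hG.crossing u hu v hv hlen h

end Stretch

/-! ### Monomials versus increasing index lists. -/

section SpreadMonomials

variable {n : ℕ}

/-- The weakly increasing list of indices of a monomial in `n` variables. -/
noncomputable def indexList (u : Fin n →₀ ℕ) : List ℕ := sortedIndices (extendMonomial u)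

theorem count_sortedIndices (u : ℕ →₀ ℕ) (i : ℕ) : (sortedIndices u).count i = u i := by
  rw [← Multiset.coe_count, sortedIndices, Multiset.sort_eq, Finsupp.count_toMultiset]

theorem extendMonomial_apply (u : Fin n →₀ ℕ) (i : Fin n) : extendMonomial u i.val = u i :=
  Finsupp.mapDomain_apply Fin.val_injective u i

theorem extendMonomial_apply_of_le (u : Fin n →₀ ℕ) {i : ℕ} (hi : n ≤ i) :
    extendMonomial u i = 0 := by
  refine Finsupp.mapDomain_of_notMem_range u i ?_
  rintro ⟨k, rfl⟩
  omega

theorem listExponent_indexList (u : Fin n →₀ ℕ) : listExponent n (indexList u) = u := by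
  ext i
  rw [listExponent_apply, indexList, count_sortedIndices, extendMonomial_apply]

theorem lt_of_mem_indexList {u : Fin n →₀ ℕ} {x : ℕ} (hx : x ∈ indexList u) : x < n := by
  by_contra! h
  have h1 := List.count_pos_iff.2 hx
  rw [indexList, count_sortedIndices, extendMonomial_apply_of_le u h] at h1
  exact lt_irrefl _ h1

theorem pairwise_indexList (u : Fin n →₀ ℕ) : (indexList u).Pairwise (· ≤ ·) :=
  Multiset.pairwise_sort _ _

theorem extendMonomial_listExponent {L : List ℕ} (hL : ∀ x ∈ L, x < n) :
    extendMonomial (listExponent n L) = Multiset.toFinsupp (L : Multiset ℕ) := by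
  ext i
  rw [Multiset.toFinsupp_apply, Multiset.coe_count]
  rcases lt_or_ge i n with hi | hi
  · exact extendMonomial_apply (listExponent n L) ⟨i, hi⟩
  · rw [extendMonomial_apply_of_le _ hi]
    exact (List.count_eq_zero.2 fun h => (hL i h).not_ge hi).symm

theorem indexList_listExponent {L : List ℕ} (hL : ∀ x ∈ L, x < n) (hs : L.Pairwise (· ≤ ·)) :
    indexList (listExponent n L) = L := by
  refine List.Perm.eq_of_pairwise' (r := (· ≤ ·)) (pairwise_indexList _) hs ?_
  rw [← Multiset.coe_eq_coe, indexList, extendMonomial_listExponent hL, sortedIndices,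
    Multiset.sort_eq, Multiset.toFinsupp_toMultiset]

theorem isTSpread_extendMonomial_iff {t : ℕ} {u : Fin n →₀ ℕ} :
    IsTSpread t (extendMonomial u) ↔ (indexList u).Pairwise fun x y => x + t ≤ y := by
  have : IsTrans ℕ fun x y => x + t ≤ y := ⟨fun a b c h1 h2 => by omega⟩
  exact List.isChain_iff_pairwise

theorem pairwise_le_of_spread {t : ℕ} {L : List ℕ} (h : L.Pairwise fun x y => x + t ≤ y) :
    L.Pairwise (· ≤ ·) :=
  h.imp fun h => by omega

/-- The `k`-th entry of a subsequence occurs no earlier than position `k` in the increasing list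
`L`. -/
theorem forall₂_take_of_sublist {L v : List ℕ} (hL : L.Pairwise (· ≤ ·)) (h : v.Sublist L) :
    List.Forall₂ (· ≤ ·) (L.take v.length) v := by
  induction L generalizing v with
  | nil => simp [List.sublist_nil.1 h]
  | cons a L ih =>
    cases v with
    | nil => simp
    | cons x v =>
      rw [List.pairwise_cons] at hL
      have hx : a ≤ x := by
        rcases List.mem_cons.1 (h.subset (List.mem_cons_self ..)) with rfl | hx
        · exact le_rfl
        · exact hL.1 x hx
      exact .cons hx (ih hL.2 h.tail)

theorem sublist_of_listExponent_le {L M : List ℕ} (hL : ∀ x ∈ L, x < n)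
    (hLs : L.Pairwise (· ≤ ·)) (hMs : M.Pairwise (· ≤ ·))
    (h : listExponent n L ≤ listExponent n M) : L.Sublist M := by
  refine List.sublist_of_subperm_of_pairwise ?_ hLs hMs
  rw [List.subperm_iff_count]
  intro a
  by_cases ha : a ∈ L
  · exact h ⟨a, hL a ha⟩
  · simp [List.count_eq_zero.2 ha]

end SpreadMonomials

/-! ### Generators of strongly stable ideals as spread systems. -/

section SpreadIdeals

variable {K : Type*} [Field K] {n t : ℕ} {I : Ideal (MvPolynomial (Fin n) K)}

theorem monomial_mem_span_iff {A : Set (Fin n →₀ ℕ)} {v : Fin n →₀ ℕ} :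
    monomial v (1 : K) ∈ Ideal.span ((fun u => monomial u (1 : K)) '' A) ↔ ∃ a ∈ A, a ≤ v := by
  classical
  rw [mem_ideal_span_monomial_image]
  simp [support_monomial]

theorem exists_minimalMonomialGenerator_le {v : Fin n →₀ ℕ} (hv : monomial v (1 : K) ∈ I) :
    ∃ u ∈ minimalMonomialGenerators I, u ≤ v := by
  obtain ⟨u, huv, hu⟩ :=
    exists_minimal_le_of_wellFoundedLT (fun v => monomial v (1 : K) ∈ I) v hv
  exact ⟨u, hu, huv⟩

theorem finite_minimalMonomialGenerators (I : Ideal (MvPolynomial (Fin n) K)) :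
    (minimalMonomialGenerators I).Finite := by
  refine WellQuasiOrderedLE.finite_of_isAntichain fun u hu v hv huv hle => huv ?_
  exact le_antisymm hle (hv.2 hu.1 hle)

theorem IsTSpreadIdeal.isTSpread_of_mem (hI : IsTSpreadIdeal t I) {u : Fin n →₀ ℕ}
    (hu : u ∈ minimalMonomialGenerators I) : IsTSpread t (extendMonomial u) := by
  obtain ⟨A, hA, rfl⟩ := hI
  obtain ⟨a, ha, hau⟩ := monomial_mem_span_iff.1 hu.1
  rw [← le_antisymm hau (hu.2 (monomial_mem_span_iff.2 ⟨a, ha, le_rfl⟩) hau)]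
  exact hA a ha

theorem IsTSpreadIdeal.eq_span (hI : IsTSpreadIdeal t I) :
    I = Ideal.span ((fun u => monomial u (1 : K)) '' minimalMonomialGenerators I) := by
  refine le_antisymm ?_ (Ideal.span_le.2 ?_)
  · obtain ⟨A, -, hA⟩ := hI
    conv_lhs => rw [hA]
    rw [Ideal.span_le]
    rintro _ ⟨a, ha, rfl⟩
    refine monomial_mem_span_iff.2 (exists_minimalMonomialGenerator_le ?_)
    rw [hA]
    exact Ideal.subset_span ⟨a, ha, rfl⟩
  · rintro _ ⟨u, hu, rfl⟩
    exact hu.1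

/-- The index lists of the `t`-spread monomials of `I`. -/
def spreadLists (t : ℕ) (I : Ideal (MvPolynomial (Fin n) K)) : Set (List ℕ) :=
  {L | (L.Pairwise fun x y => x + t ≤ y) ∧ (∀ x ∈ L, x < n) ∧
    monomial (listExponent n L) (1 : K) ∈ I}

theorem indexList_mem_spreadLists (hI : IsTSpreadIdeal t I) {u : Fin n →₀ ℕ}
    (hu : u ∈ minimalMonomialGenerators I) : indexList u ∈ spreadLists t I :=
  ⟨isTSpread_extendMonomial_iff.1 (hI.isTSpread_of_mem hu), fun _ => lt_of_mem_indexList,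
    by rw [listExponent_indexList]; exact hu.1⟩

theorem IsTSpreadStronglyStable.exchange_mem (hI : IsTSpreadStronglyStable t I) {p l : List ℕ}
    {b i : ℕ} (h : p ++ b :: l ∈ spreadLists t I) (hib : i ≤ b)
    (hs : (p ++ i :: l).Pairwise fun x y => x + t ≤ y) : p ++ i :: l ∈ spreadLists t I := by
  rcases hib.eq_or_lt with rfl | hib
  · exact h
  obtain ⟨h1, h2, h3⟩ := h
  have hb : b < n := h2 b (by simp)
  have hlt : ∀ x ∈ p ++ i :: l, x < n := by
    intro x hx
    simp only [List.mem_append, List.mem_cons] at hx h2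
    rcases hx with hx | rfl | hx
    · exact h2 x (Or.inl hx)
    · omega
    · exact h2 x (Or.inr (Or.inr hx))
  have he : listExponent n (p ++ b :: l) - Finsupp.single ⟨b, hb⟩ 1 +
      Finsupp.single ⟨i, hib.trans hb⟩ 1 = listExponent n (p ++ i :: l) := by
    ext k
    simp only [Finsupp.add_apply, Finsupp.tsub_apply, listExponent_apply, List.count_append,
      List.count_cons, Finsupp.single_apply, Fin.ext_iff, beq_iff_eq]
    split_ifs <;> omega
  have := hI.2 (listExponent n (p ++ b :: l))
    (isTSpread_extendMonomial_iff.2 (by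
      rwa [indexList_listExponent h2 (pairwise_le_of_spread h1)]))
    h3 ⟨b, hb⟩ (by simp) ⟨i, hib.trans hb⟩ hib
  rw [he] at this
  exact ⟨hs, hlt, this (isTSpread_extendMonomial_iff.2 (by
    rwa [indexList_listExponent hlt (pairwise_le_of_spread hs)]))⟩

/-- Entries are lowered from left to right. Every intermediate list stays spread: the gap before the
changed entry is that of the target, and the one after it only widens. -/
theorem IsTSpreadStronglyStable.mem_of_forall₂_le (hI : IsTSpreadStronglyStable t I)
    {p v w : List ℕ} (hv : p ++ v ∈ spreadLists t I)
    (hw : (p ++ w).Pairwise fun x y => x + t ≤ y) (h : List.Forall₂ (· ≤ ·) w v) :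
    p ++ w ∈ spreadLists t I := by
  induction h generalizing p with
  | nil => exact hv
  | @cons a b w v hab h ih =>
    have h1 : p ++ a :: v ∈ spreadLists t I := by
      refine hI.exchange_mem hv hab ?_
      have hv' := hv.1
      rw [List.pairwise_append, List.pairwise_cons] at hv' hw ⊢
      refine ⟨hv'.1, ⟨fun x hx => ?_, hv'.2.1.2⟩, fun x hx y hy => ?_⟩
      · have := hv'.2.1.1 x hx
        omega
      · rcases List.mem_cons.1 hy with rfl | hy
        · exact hw.2.2 x hx y (by simp)
        · exact hv'.2.2 x hx y (by simp [hy])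
    rw [List.append_cons] at h1 hw ⊢
    exact ih h1 hw

/-- Some generator divides `L`, but perhaps not as a prefix. The prefix of `L` of the same length is
entrywise at most that generator, hence lies in `I`; if it is proper, recurse on it. -/
theorem IsTSpreadStronglyStable.exists_prefix (hI : IsTSpreadStronglyStable t I) {L : List ℕ}
    (hL : L ∈ spreadLists t I) : ∃ w ∈ indexList '' minimalMonomialGenerators I, w <+: L := by
  induction hN : L.length using Nat.strong_induction_on generalizing L with
  | _ N ih =>
    subst hN
    obtain ⟨u, hu, hle⟩ := exists_minimalMonomialGenerator_le hL.2.2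
    have hLs := pairwise_le_of_spread hL.1
    have hsub : (indexList u).Sublist L := by
      refine sublist_of_listExponent_le (n := n) (fun _ => lt_of_mem_indexList)
        (pairwise_indexList u) hLs ?_
      rwa [listExponent_indexList]
    rcases hsub.length_le.lt_or_eq with hlen | hlen
    · have hmem : [] ++ L.take (indexList u).length ∈ spreadLists t I :=
        hI.mem_of_forall₂_le (indexList_mem_spreadLists hI.1 hu)
          (hL.1.sublist (List.take_sublist _ _)) (forall₂_take_of_sublist hLs hsub)
      obtain ⟨w, hw, hwp⟩ := ih _ (by simp [hlen]) hmem rfl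
      exact ⟨w, hw, hwp.trans (List.take_prefix _ _)⟩
    · exact ⟨_, ⟨u, hu, rfl⟩, hsub.eq_of_length hlen ▸ List.prefix_rfl⟩

/-- The minimal generators of a `t`-spread strongly stable ideal form a spread system. -/
theorem IsTSpreadStronglyStable.isSpreadSystem (hI : IsTSpreadStronglyStable t I) :
    IsSpreadSystem t (indexList '' minimalMonomialGenerators I) where
  spread := by
    rintro _ ⟨u, hu, rfl⟩
    exact (indexList_mem_spreadLists hI.1 hu).1
  exchange := by
    rintro p b l i ⟨u, hu, h⟩ hib hp
    have hmem := h ▸ indexList_mem_spreadLists hI.1 hu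
    refine hI.exists_prefix (hI.exchange_mem hmem hib.le ?_)
    have hs := hmem.1
    rw [List.pairwise_append, List.pairwise_cons] at hs ⊢
    refine ⟨hs.1, ⟨fun x hx => ?_, hs.2.1.2⟩, fun x hx y hy => ?_⟩
    · have := hs.2.1.1 x hx
      omega
    · rcases List.mem_cons.1 hy with rfl | hy
      · exact hp x hx
      · exact hs.2.2 x hx y (by simp [hy])
  crossing := by
    rintro _ ⟨u, hu, rfl⟩ _ ⟨v, hv, rfl⟩ hlen h
    have hu' := indexList_mem_spreadLists hI.1 hu
    -- If the truncation of `u` were entrywise below `v`, it would belong to `I` and properly divide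
    -- `u`, against minimality.
    have hmem : [] ++ (indexList u).take (indexList v).length ∈ spreadLists t I :=
      hI.mem_of_forall₂_le (indexList_mem_spreadLists hI.1 hv)
        (hu'.1.sublist (List.take_sublist _ _)) h
    rw [List.nil_append] at hmem
    have hle := listExponent_le_of_prefix (n := n)
      (List.take_prefix (indexList v).length (indexList u))
    have h1 := hu.2 hmem.2.2 (by rwa [listExponent_indexList] at hle)
    have h2 : (indexList u).Sublist ((indexList u).take (indexList v).length) :=
      sublist_of_listExponent_le (n := n) hu'.2.1 (pairwise_indexList u)
        (pairwise_le_of_spread hmem.1) (by rwa [listExponent_indexList])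
    have := h2.length_le
    rw [List.length_take] at this
    omega

theorem stretch_extendMonomial (u : Fin n →₀ ℕ) :
    stretch (extendMonomial u) =
      Multiset.toFinsupp (stretchList 0 (indexList u) : Multiset ℕ) := by
  rw [stretch, ← mapIdx_add_eq_stretchList]
  rfl

theorem HasRoomForStretch.lt_of_mem {m : ℕ} (hm : HasRoomForStretch m I) :
    ∀ L ∈ stretchList 0 '' (indexList '' minimalMonomialGenerators I), ∀ x ∈ L, x < m := by
  rintro _ ⟨_, ⟨u, hu, rfl⟩, rfl⟩ x hx
  refine hm u hu x ?_
  rw [stretch_extendMonomial, Finsupp.mem_support_iff, Multiset.toFinsupp_apply,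
    Multiset.coe_count]
  exact (List.count_pos_iff.2 hx).ne'

/-- `listExponent m` discards indices that are at least `m`; the room hypothesis ensures that no
index of `σ(u)` is lost. -/
theorem stretchedIdeal_eq_span {m : ℕ} (hm : HasRoomForStretch m I) :
    stretchedIdeal m I = Ideal.span ((fun c => monomial c (1 : K)) ''
      (listExponent m '' (stretchList 0 '' (indexList '' minimalMonomialGenerators I)))) := by
  rw [stretchedIdeal]
  congr 1
  ext f
  constructor
  · rintro ⟨w, ⟨u, hu, hw⟩, rfl⟩
    refine ⟨w, ⟨_, ⟨_, ⟨u, hu, rfl⟩, rfl⟩, ?_⟩, rfl⟩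
    ext i
    rw [← extendMonomial_apply, ← extendMonomial_apply w, hw, stretch_extendMonomial,
      extendMonomial_listExponent (hm.lt_of_mem _ ⟨_, ⟨u, hu, rfl⟩, rfl⟩)]
  · rintro ⟨_, ⟨_, ⟨_, ⟨u, hu, rfl⟩, rfl⟩, rfl⟩, rfl⟩
    refine ⟨_, ⟨u, hu, ?_⟩, rfl⟩
    rw [stretch_extendMonomial,
      extendMonomial_listExponent (hm.lt_of_mem _ ⟨_, ⟨u, hu, rfl⟩, rfl⟩)]

theorem listExponent_image_indexList (A : Set (Fin n →₀ ℕ)) :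
    listExponent n '' (indexList '' A) = A := by
  rw [Set.image_image]
  simp [listExponent_indexList]

/-- A `t`-spread strongly stable ideal and its stretched ideal have the same Betti numbers. -/
theorem IsTSpreadStronglyStable.exists_hasBettiNumbers (hI : IsTSpreadStronglyStable t I) {m : ℕ}
    (hm : HasRoomForStretch m I) :
    ∃ β, HasBettiNumbers I β ∧ HasBettiNumbers (stretchedIdeal m I) β := by
  classical
  obtain ⟨G, hG⟩ := ((finite_minimalMonomialGenerators I).image indexList).exists_finset_coe
  have hsys := hI.isSpreadSystem
  have hstretch := hsys.stretch
  have hlt := hm.lt_of_mem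
  rw [stretchedIdeal_eq_span hm]
  have h1 : ∀ L ∈ G, ∀ x ∈ L, x < n := by
    intro L hL
    obtain ⟨u, -, rfl⟩ := hG ▸ Finset.mem_coe.2 hL
    exact fun _ => lt_of_mem_indexList
  have hspan : I = Ideal.span ((fun c => monomial c (1 : K)) ''
      (listExponent n '' (G : Set (List ℕ)))) := by
    rw [hG, listExponent_image_indexList]
    exact hI.1.eq_span
  rw [← hG] at hsys hstretch hlt ⊢
  rw [← Finset.coe_image] at hstretch hlt ⊢
  refine ⟨_, hspan ▸ hsys.hasBettiNumbers (K := K) h1, ?_⟩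
  convert hstretch.hasBettiNumbers (K := K) (fun u hu => hlt u hu) using 1
  funext i j
  -- Injectivity keeps distinct generators distinct, so the two Betti formulas match term by term.
  rw [Finset.sum_image fun _ _ _ _ h => stretchList_injective 0 h]
  refine Finset.sum_congr rfl fun u _ => ?_
  rw [length_stretchList, ← gapCount_stretchList t 0 0 u]

end SpreadIdeals

theorem theorem1p9 {K : Type*} [Field K] (n t : ℕ) (I : Ideal (MvPolynomial (Fin n) K))
    (hI : IsTSpreadStronglyStable t I) (m : ℕ) (hm : HasRoomForStretch m I) :
    Nonempty (MinimalGradedFreeResolution I) ∧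
    Nonempty (MinimalGradedFreeResolution (stretchedIdeal m I)) ∧
    ∀ (F : MinimalGradedFreeResolution I)
      (F' : MinimalGradedFreeResolution (stretchedIdeal m I)) (i j : ℕ),
      F.betti i j = F'.betti i j := by
  obtain ⟨β, ⟨F₀, hF₀⟩, ⟨F₀', hF₀'⟩⟩ := hI.exists_hasBettiNumbers hm
  refine ⟨⟨F₀⟩, ⟨F₀'⟩, fun F F' i j => ?_⟩
  rw [F.betti_eq_betti F₀, F'.betti_eq_betti F₀', hF₀, hF₀']
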